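/- **Theorem.** Let $\mathcal Q_{\mathbb N}$ be the universal (unital) $C^*$-algebra generated by isometries $s_n$ ($n\in\mathbb N^\times=\{1,2,3,\dots\}$) with range projections $e_n=s_ns_n^*$ and a unitary $u$, subject to the relations $$s_ns_m=s_{nm},\qquad s_nu=u^ns_n,\qquad \sum_{k=0}^{n-1}u^ke_nu^{-k}=1\qquad(n,m\in\mathbb N^\times).$$ Let $\mathcal F\subseteq\mathcal Q_{\mathbb N}$ be the $C^*$-subalgebra generated by $u$ and all $e_n$ (a Bunce–Deddens algebra). For a point $t=(t_p)_p$ of the torus $\mathbb T^{\{p\ \mathrm{prime}\}}$ let $\alpha_t$ be the endomorphism of $\mathcal Q_{\mathbb N}$ with $\alpha_t(u)=u$ and $\alpha_t(s_n)=\prod_p t_p^{v_p(n)}\,s_n$, and put $E(x)=\int\alpha_t(x)\,dt$ (normalised Haar measure). A one-parameter automorphism group $(\lambda_t)_{t\in\mathbb R}$ of a $C^*$-algebra $A$ is understood to be strongly continuous. A state $\tau$ on $A$ is a *1-KMS state* for $(\lambda_t)$ if for all $x,y\in A$ there is a function $F_{x,y}$, continuous on the strip $\{0\le\operatorname{Im}z\le1\}$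 and holomorphic in its interior, such that $F_{x,y}(t)=\tau(x\lambda_t(y))$ and $F_{x,y}(t+i)=\tau(\lambda_t(y)x)$ for all $t\in\mathbb R$. Then: 1. $\mathcal F$ has exactly one tracial state $\tau_0$, and $E$ maps $\mathcal Q_{\mathbb N}$ into $\mathcal F$. 2. There is exactly one state $\tau$ on $\mathcal Q_{\mathbb N}$ for which there exists a one-parameter automorphism group $(\lambda_t)$ of $\mathcal Q_{\mathbb N}$ such that $\tau$ is a 1-KMS state for $(\lambda_t)$ and $\lambda_t(u)=u$, $\lambda_t(e_n)=e_n$ for all $n\in\mathbb N^\times$ and $t\in\mathbb R$. 3. This state is $\tau=\tau_0\circ E$. 4. There is exactly one one-parameter automorphism group $(\lambda_t)$ of $\mathcal Q_{\mathbb N}$ for which $\tau$ is a 1-KMS state, and it satisfies $\lambda_t(s_n)=n^{it}s_n$ and $\lambda_t(u)=u$ for all $n\in\mathbb N^\times$ and $t\in\mathbb R$. -/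

import Mathlib

open scoped ENNReal CStarAlgebra

noncomputable section

namespace CuntzQN

/-! ### The universal `C⋆`-algebra `Q_ℕ` -/

/-- The defining relations of `Q_ℕ`, for a family `s` indexed by the positive integers and an
element `u` of a unital `C⋆`-algebra. -/
structure Relations {B : Type*} [CStarAlgebra B] (s : ℕ+ → B) (u : B) : Prop where
  isometry : ∀ n, star (s n) * s n = 1
  unitary : u ∈ unitary B
  mul : ∀ n m, s n * s m = s (n * m)
  semiconj : ∀ n, s n * u = u ^ (n : ℕ) * s n
  sum_eq_one : ∀ n : ℕ+,
    ∑ k ∈ Finset.range (n : ℕ), u ^ k * (s n * star (s n)) * star (u ^ k) = 1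

/-- A realisation of the generators and relations in a nonzero unital `C⋆`-algebra. -/
structure Realisation : Type 1 where
  carrier : Type
  [cstar : CStarAlgebra carrier]
  [nontrivial : Nontrivial carrier]
  s : ℕ+ → carrier
  u : carrier
  rel : Relations s u

instance (i : Realisation) : CStarAlgebra i.carrier := i.cstar

instance (i : Realisation) : Nontrivial i.carrier := i.nontrivial

/-- The `C⋆`-algebra of all bounded families, indexed by the realisations of the relations. -/
abbrev Ambient : Type 1 := lp Realisation.carrier ∞

instance : CStarAlgebra Ambient where

theorem norm_le_one_of_isometry {B : Type*} [CStarAlgebra B] {x : B} (h : star x * x = 1) :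
    ‖x‖ ≤ 1 := by
  have h1 : ‖x‖ * ‖x‖ = ‖(1 : B)‖ := by rw [← CStarRing.norm_star_mul_self, h]
  have h2 : ‖(1 : B)‖ ≤ 1 := by
    rcases subsingleton_or_nontrivial B with hB | hB
    · rw [Subsingleton.elim (1 : B) 0, norm_zero]; exact zero_le_one
    · exact (CStarRing.norm_one (E := B)).le
  nlinarith [norm_nonneg x]

/-- The family of all realisations of the generator `s n`. -/
def ambientS (n : ℕ+) : Ambient :=
  ⟨fun i => i.s n, memℓp_infty ⟨1, by
    rintro _ ⟨i, rfl⟩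
    exact norm_le_one_of_isometry (i.rel.isometry n)⟩⟩

/-- The family of all realisations of the generator `u`. -/
def ambientU : Ambient :=
  ⟨fun i => i.u, memℓp_infty ⟨1, by
    rintro _ ⟨i, rfl⟩
    exact norm_le_one_of_isometry (Unitary.mem_iff.1 i.rel.unitary).1⟩⟩

/-- The closed `⋆`-subalgebra generated by the universal families of generators. -/
def universalSubalgebra : StarSubalgebra ℂ Ambient :=
  (StarAlgebra.adjoin ℂ (insert ambientU (Set.range ambientS))).topologicalClosure

instance : IsClosed (universalSubalgebra : Set Ambient) :=
  StarSubalgebra.isClosed_topologicalClosure _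

/-- `Q_ℕ`: the universal `C⋆`-algebra generated by isometries `s n` and a unitary `u` subject to
`Relations`, realised inside the product of all its realisations. -/
def QN : Type 1 := universalSubalgebra

/-- The `C⋆`-algebra structure of a closed `⋆`-subalgebra. -/
def QN.cstarAlgebra : CStarAlgebra QN := StarSubalgebra.cstarAlgebra universalSubalgebra

instance : CStarAlgebra QN := QN.cstarAlgebra

theorem ambientU_mem : ambientU ∈ universalSubalgebra :=
  StarSubalgebra.le_topologicalClosure _ (StarAlgebra.subset_adjoin ℂ _ (Set.mem_insert _ _))

theorem ambientS_mem (n : ℕ+) : ambientS n ∈ universalSubalgebra :=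
  StarSubalgebra.le_topologicalClosure _
    (StarAlgebra.subset_adjoin ℂ _ (Set.mem_insert_of_mem _ ⟨n, rfl⟩))

/-- The isometries `s n` of `Q_ℕ`. -/
def s (n : ℕ+) : QN := ⟨ambientS n, ambientS_mem n⟩

/-- The unitary `u` of `Q_ℕ`. -/
def u : QN := ⟨ambientU, ambientU_mem⟩

/-- The range projections `e n = s n (s n)⋆`. -/
def e (n : ℕ+) : QN := s n * star (s n)

/-- The inclusion of `Q_ℕ` into the product of all realisations. -/
def inclusion : QN →⋆ₐ[ℂ] Ambient where
  toFun x := x.1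
  map_one' := rfl
  map_mul' _ _ := rfl
  map_zero' := rfl
  map_add' _ _ := rfl
  commutes' _ := rfl
  map_star' _ := rfl

/-- Evaluation of an element of `Q_ℕ` in a realisation. -/
def eval (i : Realisation) : QN →⋆ₐ[ℂ] i.carrier where
  toFun x := x.1 i
  map_one' := rfl
  map_mul' _ _ := rfl
  map_zero' := rfl
  map_add' _ _ := rfl
  commutes' _ := rfl
  map_star' _ := rfl

@[simp] theorem eval_s (i : Realisation) (n : ℕ+) : eval i (s n) = i.s n := rfl

@[simp] theorem eval_u (i : Realisation) : eval i u = i.u := rfl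

theorem ext_eval {x y : QN} (h : ∀ i, eval i x = eval i y) : x = y :=
  Subtype.ext (lp.ext (funext h))

/-- The generators of `Q_ℕ` satisfy the defining relations. -/
theorem relations : Relations s u where
  isometry n := ext_eval fun i => i.rel.isometry n
  unitary := Unitary.mem_iff.2
    ⟨ext_eval fun i => (Unitary.mem_iff.1 i.rel.unitary).1,
      ext_eval fun i => (Unitary.mem_iff.1 i.rel.unitary).2⟩
  mul n m := ext_eval fun i => i.rel.mul n m
  semiconj n := ext_eval fun i => i.rel.semiconj n
  sum_eq_one n := ext_eval fun i => by
    simpa only [map_sum, map_mul, map_star, map_pow, map_one, eval_s, eval_u]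
      using i.rel.sum_eq_one n

/-- The universal property of `Q_ℕ`, existence part. -/
theorem exists_lift {B : Type} [CStarAlgebra B] {s' : ℕ+ → B} {u' : B} (h : Relations s' u') :
    ∃ φ : QN →⋆ₐ[ℂ] B, (∀ n, φ (s n) = s' n) ∧ φ u = u' := by
  rcases subsingleton_or_nontrivial B with hB | hB
  · exact ⟨{ toFun := fun _ => 0
             map_one' := Subsingleton.elim _ _
             map_mul' := fun _ _ => Subsingleton.elim _ _
             map_zero' := Subsingleton.elim _ _
             map_add' := fun _ _ => Subsingleton.elim _ _
             commutes' := fun _ => Subsingleton.elim _ _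
             map_star' := fun _ => Subsingleton.elim _ _ },
      fun _ => Subsingleton.elim _ _, Subsingleton.elim _ _⟩
  · exact ⟨eval ⟨B, s', u', h⟩, fun _ => rfl, rfl⟩

/-- The elements of `Q_ℕ` are exhausted by closed `⋆`-subalgebras containing the generators. -/
theorem mem_of_closed (S : StarSubalgebra ℂ QN) (hS : IsClosed (S : Set QN))
    (hu : u ∈ S) (hs : ∀ n, s n ∈ S) (x : QN) : x ∈ S := by
  have hle : universalSubalgebra ≤ S.map inclusion := by
    refine StarSubalgebra.topologicalClosure_minimal ?_ ?_
    · refine StarAlgebra.adjoin_le ?_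
      rintro _ (rfl | ⟨n, rfl⟩)
      · exact ⟨u, hu, rfl⟩
      · exact ⟨s n, hs n, rfl⟩
    · have hc : IsClosed (universalSubalgebra : Set Ambient) := inferInstance
      exact hc.isClosedEmbedding_subtypeVal.isClosedMap _ hS
  obtain ⟨y, hy, hyx⟩ := hle x.2
  have : y = x := Subtype.ext hyx
  exact this ▸ hy

/-- The universal property of `Q_ℕ`, uniqueness part. -/
theorem hom_ext {B : Type*} [CStarAlgebra B] {φ ψ : QN →⋆ₐ[ℂ] B}
    (hs : ∀ n, φ (s n) = ψ (s n)) (hu : φ u = ψ u) : φ = ψ := by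
  refine StarAlgHom.ext fun x => ?_
  refine mem_of_closed (StarAlgHom.equalizer φ ψ) ?_ hu hs x
  exact isClosed_eq (map_continuous φ) (map_continuous ψ)

/-- The `C⋆`-subalgebra `F` of `Q_ℕ` generated by `u` and the projections `e n`. -/
def F : StarSubalgebra ℂ QN :=
  (StarAlgebra.adjoin ℂ (insert u (Set.range e))).topologicalClosure

/-! ### The gauge action of the torus and the expectation onto `F` -/

/-- The compact group `∏_p 𝕋`, with one factor for each prime `p`. -/
abbrev Torus : Type := Nat.Primes → Circle

/-- The character `n ↦ ∏_p t_p ^ v_p(n)` of the multiplicative semigroup of positive integers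
which is determined by a point of the torus. -/
def weight (t : Torus) (n : ℕ+) : Circle :=
  ∏ᶠ p : Nat.Primes, t p ^ (n : ℕ).factorization p

theorem weight_finite (t : Torus) (n : ℕ+) :
    (Function.mulSupport fun p : Nat.Primes => t p ^ (n : ℕ).factorization p).Finite := by
  refine Set.Finite.subset (((n : ℕ).factorization.support.finite_toSet).preimage
    (Nat.Primes.coe_nat_injective.injOn)) ?_
  intro p hp
  simp only [Set.mem_preimage, Finset.mem_coe, Finsupp.mem_support_iff]
  intro h0
  exact hp (by simp [h0])

theorem weight_mul (t : Torus) (n m : ℕ+) : weight t (n * m) = weight t n * weight t m := by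
  unfold weight
  rw [← finprod_mul_distrib (weight_finite t n) (weight_finite t m)]
  refine finprod_congr fun p => ?_
  rw [PNat.mul_coe, Nat.factorization_mul n.ne_zero m.ne_zero, Finsupp.add_apply, pow_add]

theorem star_circle_mul (z : Circle) : star (z : ℂ) * (z : ℂ) = 1 := by
  rw [Complex.star_def, ← Complex.normSq_eq_conj_mul_self, Circle.normSq_coe, Complex.ofReal_one]

theorem Relations.rotate {B : Type*} [CStarAlgebra B] {s : ℕ+ → B} {u : B} (h : Relations s u)
    (t : Torus) : Relations (fun n => (weight t n : ℂ) • s n) u where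
  isometry n := by
    rw [star_smul, smul_mul_smul_comm, star_circle_mul, one_smul, h.isometry]
  unitary := h.unitary
  mul n m := by
    rw [smul_mul_smul_comm, h.mul, weight_mul, Circle.coe_mul]
  semiconj n := by
    rw [smul_mul_assoc, h.semiconj, mul_smul_comm]
  sum_eq_one n := by
    have : ((weight t n : ℂ) • s n) * star ((weight t n : ℂ) • s n) = s n * star (s n) := by
      rw [star_smul, smul_mul_smul_comm, mul_comm, star_circle_mul, one_smul]
    rw [this]
    exact h.sum_eq_one n

/-- Multiplication of the isometries of a realisation by the values of a character. -/
def Realisation.rotate (i : Realisation) (t : Torus) : Realisation :=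
  ⟨i.carrier, fun n => (weight t n : ℂ) • i.s n, i.u, i.rel.rotate t⟩

/-- The permutation of coordinates of the ambient algebra which induces the gauge action. -/
def ambientGauge (t : Torus) : Ambient →⋆ₐ[ℂ] Ambient where
  toFun x := ⟨fun i => (x : ∀ i : Realisation, i.carrier) (i.rotate t), memℓp_infty (by
    obtain ⟨C, hC⟩ := memℓp_infty_iff.1 (lp.memℓp x)
    exact ⟨C, by rintro _ ⟨i, rfl⟩; exact hC ⟨i.rotate t, rfl⟩⟩)⟩
  map_one' := rfl
  map_mul' _ _ := rfl
  map_zero' := rfl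
  map_add' _ _ := rfl
  commutes' _ := rfl
  map_star' _ := rfl

theorem ambientGauge_mem (t : Torus) {x : Ambient} (hx : x ∈ universalSubalgebra) :
    ambientGauge t x ∈ universalSubalgebra := by
  have hle : universalSubalgebra ≤ universalSubalgebra.comap (ambientGauge t) := by
    refine StarSubalgebra.topologicalClosure_minimal ?_ ?_
    · refine StarAlgebra.adjoin_le ?_
      rintro _ (rfl | ⟨n, rfl⟩)
      · exact ambientU_mem
      · have : ambientGauge t (ambientS n) = (weight t n : ℂ) • ambientS n := rfl
        change ambientGauge t (ambientS n) ∈ universalSubalgebra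
        rw [this]
        exact universalSubalgebra.smul_mem (ambientS_mem n) _
    · have hc : IsClosed (universalSubalgebra : Set Ambient) := inferInstance
      exact hc.preimage (map_continuous (ambientGauge t))
  exact hle hx

/-- The gauge action of the torus on `Q_ℕ`. -/
def gauge (t : Torus) : QN →⋆ₐ[ℂ] QN where
  toFun x := ⟨ambientGauge t x.1, ambientGauge_mem t x.2⟩
  map_one' := rfl
  map_mul' _ _ := rfl
  map_zero' := rfl
  map_add' _ _ := rfl
  commutes' _ := rfl
  map_star' _ := rfl

@[simp] theorem gauge_s (t : Torus) (n : ℕ+) : gauge t (s n) = (weight t n : ℂ) • s n := rfl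

@[simp] theorem gauge_u (t : Torus) : gauge t u = u := rfl

instance : MeasurableSpace Circle := borel Circle

instance : BorelSpace Circle := ⟨rfl⟩

/-- The Haar probability measure of the torus. -/
def torusHaar : MeasureTheory.Measure Torus := MeasureTheory.Measure.haarMeasure ⊤

/-- The expectation `E x = ∫ α_t(x) dt`, where `α` is the gauge action of the torus. -/
def expectation (x : QN) : QN := ∫ t, gauge t x ∂torusHaar

/-! ### States, one-parameter groups and the KMS condition -/

/-- States of a unital complex `⋆`-algebra: normalised positive linear functionals. -/
def IsState {A : Type*} [Semiring A] [Algebra ℂ A] [Star A] (τ : A →ₗ[ℂ] ℂ) : Prop :=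
  τ 1 = 1 ∧ ∀ x, ∃ r : ℝ, 0 ≤ r ∧ τ (star x * x) = r

/-- Tracial states. -/
def IsTracialState {A : Type*} [Semiring A] [Algebra ℂ A] [Star A] (τ : A →ₗ[ℂ] ℂ) : Prop :=
  IsState τ ∧ ∀ x y, τ (x * y) = τ (y * x)

/-- A (strongly continuous) one-parameter group of automorphisms of a `C⋆`-algebra. -/
structure OneParameterGroup (A : Type*) [CStarAlgebra A] where
  toFun : ℝ → (A ≃⋆ₐ[ℂ] A)
  map_zero : ∀ x, toFun 0 x = x
  map_add : ∀ t t' x, toFun (t + t') x = toFun t (toFun t' x)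
  continuous : ∀ x, Continuous fun t => toFun t x

instance (A : Type*) [CStarAlgebra A] :
    CoeFun (OneParameterGroup A) (fun _ => ℝ → (A ≃⋆ₐ[ℂ] A)) := ⟨OneParameterGroup.toFun⟩

/-- The `β`-KMS condition for `τ` with respect to `lam`: for all `x, y` there is a function,
continuous on the strip `0 ≤ Im z ≤ β` and holomorphic in its interior, with boundary values
`τ (x λ_t(y))` at `t` and `τ (λ_t(y) x)` at `t + iβ`. -/
def IsKMS {A : Type*} [CStarAlgebra A] (β : ℝ) (lam : OneParameterGroup A) (τ : A →ₗ[ℂ] ℂ) :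
    Prop :=
  ∀ x y : A, ∃ f : ℂ → ℂ,
    ContinuousOn f {z | 0 ≤ z.im ∧ z.im ≤ β} ∧
    DifferentiableOn ℂ f {z | 0 < z.im ∧ z.im < β} ∧
    (∀ t : ℝ, f t = τ (x * lam t y)) ∧
    ∀ t : ℝ, f (t + β * Complex.I) = τ (lam t y * x)

/-- `τ` is a state on `Q_ℕ` which is 1-KMS for some one-parameter group fixing `u` and all
`e n`. -/
def IsCanonicalKMSState (τ : QN →ₗ[ℂ] ℂ) : Prop :=
  IsState τ ∧ ∃ lam : OneParameterGroup QN,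
    (∀ t, lam t u = u ∧ ∀ n, lam t (e n) = e n) ∧ IsKMS 1 lam τ

end CuntzQN

end

noncomputable section

namespace CuntzQN

/-! ### Holomorphic functions on a horizontal strip -/

open Complex Set Filter Topology Interval

/-! Everything is reduced to central states, those with `u` and all `e n` in their centralizer
(`IsCentral`). A state that is KMS for a flow fixing `u` and the `e n` is central, because the KMS
function of a fixed element is constant.

There is at most one central state (`IsCentral.eq`). The monomials u^i s_a s_b^* u^j span a dense
subalgebra, and centrality determines their values. If a = b, the partition of unity by translates
of e_a gives 1/a or 0. If a ≠ b, the value is unchanged under multiplication by every power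
u^{(b-a)r}; these powers are orthonormal for the state, so Bessel's inequality forces the value to
be 0. A central state exists: take an ultrafilter limit of Cesàro means of diagonal coefficients in
the representation of Q_ℕ on ℓ²(ℤ) (`exists_isCentral`).

Uniqueness then yields further identities, each time because some modified functional is again
central. Invariance under the gauge action gives τ = τ ∘ E. A trace on F composed with E is central,
so F has only one trace. The functional n τ(s_n · s_n^*) is central, so τ(s_n x) = n⁻¹ τ(x s_n),
which on monomials is the KMS relation for the flow s_n ↦ n^{it} s_n.

For the uniqueness of the flow nothing is assumed about its action on `u` and `e n`. Let σ be the
standard flow and let τ be KMS for μ. For a monomial y, multiplying the KMS function of (y, x) by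
(a/b)^{iz} makes its two boundary functions equal. It is bounded by a closed graph argument
(`IsKMSFunction.exists_bound`), hence constant by Liouville, so τ(σ_t(y) μ_t(x)) = τ(yx). Comparing
with μ = σ shows that μ_t(x) − σ_t(x) is τ-null.

It remains to see that τ is faithful. The expectation E is faithful, so this is a question about F.
Null elements are killed by the GNS representation, in which `u` has the whole circle as spectrum.
Such a representation is injective on F, since F is approximated by algebras of matrices over C*(u).
-/

/-- A continuous function which is holomorphic off a horizontal line is holomorphic. -/
theorem differentiableOn_of_off_line {f : ℂ → ℂ} {U : Set ℂ} (hU : IsOpen U) (l : ℝ)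
    (hc : ContinuousOn f U) (hd : ∀ z ∈ U, z.im ≠ l → DifferentiableAt ℂ f z) :
    DifferentiableOn ℂ f U := by
  refine (isConservativeOn_and_continuousOn_iff_isDifferentiableOn hU).1 ⟨fun z w hzw => ?_, hc⟩
  rw [← add_eq_zero_iff_eq_neg, wedgeIntegral_add_wedgeIntegral_eq]
  -- Cauchy's theorem on a rectangle needs differentiability only in the open interior, so the
  -- exceptional line may run along an edge. A rectangle crossed by the line is cut along it, and
  -- Morera's theorem concludes.
  have key : ∀ y₁ ∈ [[z.im, w.im]], ∀ y₂ ∈ [[z.im, w.im]],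
      l ∉ Ioo (min y₁ y₂) (max y₁ y₂) →
      (∫ x : ℝ in z.re..w.re, f (x + y₁ * I)) - (∫ x : ℝ in z.re..w.re, f (x + y₂ * I)) +
      I • (∫ y : ℝ in y₁..y₂, f (w.re + y * I)) -
      I • (∫ y : ℝ in y₁..y₂, f (z.re + y * I)) = 0 := by
    intro y₁ h₁ y₂ h₂ hl
    have hsub : [[z.re, w.re]] ×ℂ [[y₁, y₂]] ⊆ U :=
      (reProdIm_subset_iff.2 (prod_mono le_rfl (uIcc_subset_uIcc h₁ h₂))).trans hzw
    have := integral_boundary_rect_eq_zero_of_continuousOn_of_differentiableOn f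
      (z.re + y₁ * I) (w.re + y₂ * I) (by simpa using hc.mono hsub) (by
        simp only [add_re, ofReal_re, mul_re, I_re, mul_zero, ofReal_im, I_im, mul_one, sub_self,
          add_zero, add_im, mul_im, zero_add]
        intro p hp
        refine (hd p (hsub ⟨Ioo_subset_Icc_self hp.1, Ioo_subset_Icc_self hp.2⟩) ?_
          ).differentiableWithinAt
        rintro rfl
        exact hl hp.2)
    simpa using this
  by_cases hl : l ∈ Ioo (min z.im w.im) (max z.im w.im)
  · have hlm : l ∈ [[z.im, w.im]] := Ioo_subset_Icc_self hl
    have hv : ∀ x ∈ [[z.re, w.re]], ∀ y₁ ∈ [[z.im, w.im]], ∀ y₂ ∈ [[z.im, w.im]],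
        IntervalIntegrable (fun y : ℝ => f (x + y * I)) MeasureTheory.volume y₁ y₂ := by
      intro x hx y₁ h₁ y₂ h₂
      refine ContinuousOn.intervalIntegrable (hc.comp (by fun_prop) ?_)
      intro y hy
      exact hzw ⟨by simpa using hx, by simpa using uIcc_subset_uIcc h₁ h₂ hy⟩
    have e₁ := key _ left_mem_uIcc l hlm (by
      rcases le_total z.im w.im with h | h
      · have : z.im < l := by simpa [h] using hl.1
        simp [this.le]
      · have : l < z.im := by simpa [h] using hl.2
        simp [this.le])
    have e₂ := key l hlm _ right_mem_uIcc (by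
      rcases le_total z.im w.im with h | h
      · have : l < w.im := by simpa [h] using hl.2
        simp [this.le]
      · have : w.im < l := by simpa [h] using hl.1
        simp [this.le])
    rw [← intervalIntegral.integral_add_adjacent_intervals
        (hv _ right_mem_uIcc _ left_mem_uIcc l hlm) (hv _ right_mem_uIcc l hlm _ right_mem_uIcc),
      ← intervalIntegral.integral_add_adjacent_intervals
        (hv _ left_mem_uIcc _ left_mem_uIcc l hlm) (hv _ left_mem_uIcc l hlm _ right_mem_uIcc)]
    simp only [smul_eq_mul] at e₁ e₂ ⊢
    linear_combination e₁ + e₂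
  · exact key _ left_mem_uIcc _ right_mem_uIcc hl

/-- A function on a rectangle, holomorphic in the interior, which vanishes on the bottom side,
vanishes identically. -/
theorem eq_zero_of_bottom_eq_zero {f : ℂ → ℂ} {r : ℝ} (hr : 0 < r)
    (hc : ContinuousOn f (Icc (-r) r ×ℂ Icc 0 1))
    (hd : DifferentiableOn ℂ f (Ioo (-r) r ×ℂ Ioo 0 1))
    (h0 : ∀ t : ℝ, t ∈ Icc (-r) r → f t = 0) {z : ℂ} (hz : z ∈ Icc (-r) r ×ℂ Icc 0 1) :
    f z = 0 := by
  -- Extension by 0 below the real axis is continuous because `f` vanishes there, hence holomorphic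
  -- across the axis. The identity theorem then applies from the lower half.
  let g : ℂ → ℂ := fun z => if 0 ≤ z.im then f z else 0
  let U : Set ℂ := Ioo (-r) r ×ℂ Ioo (-1) 1
  have hU : IsOpen U := isOpen_Ioo.reProdIm isOpen_Ioo
  have hgc : ContinuousOn g U := by
    refine ContinuousOn.if ?_ ?_ continuousOn_const
    · intro a ha
      have : a.im = 0 := by
        have := ha.2
        rwa [show {a : ℂ | 0 ≤ a.im} = {a | (0:ℝ) ≤ a.im} from rfl, frontier_setOfPred_le_im] at this
      have ha' : a = (a.re : ℂ) := by apply Complex.ext <;> simp [this]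
      rw [ha']
      exact h0 _ (Ioo_subset_Icc_self ha.1.1)
    · refine hc.mono ?_
      rintro a ⟨ha, ha'⟩
      rw [(isClosed_le continuous_const continuous_im).closure_eq] at ha'
      exact ⟨Ioo_subset_Icc_self ha.1, ha', ha.2.2.le⟩
  have hgd : DifferentiableOn ℂ g U := by
    refine differentiableOn_of_off_line hU 0 hgc fun z hz hz0 => ?_
    rcases lt_or_gt_of_ne hz0 with h | h
    · refine (differentiableAt_const (0 : ℂ)).congr_of_eventuallyEq ?_
      filter_upwards [(isOpen_lt continuous_im continuous_const).mem_nhds h] with w hw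
      exact if_neg (not_le.2 hw)
    · have : DifferentiableAt ℂ f z :=
        hd.differentiableAt ((isOpen_Ioo.reProdIm isOpen_Ioo).mem_nhds ⟨hz.1, h, hz.2.2⟩)
      refine this.congr_of_eventuallyEq ?_
      filter_upwards [(isOpen_lt continuous_const continuous_im).mem_nhds h] with w hw
      exact if_pos (le_of_lt hw)
  have hconv : IsPreconnected U := by
    have : Convex ℝ U := ((convex_Ioo (-r) r).linear_preimage reLm).inter
      ((convex_Ioo (-1) 1).linear_preimage imLm)
    exact this.isPreconnected
  have hgz : EqOn g 0 U := by
    have hmem : (-(1 / 2 : ℝ) * I : ℂ) ∈ U := by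
      refine ⟨by simp [hr], by simp; norm_num⟩
    refine (hgd.analyticOnNhd hU).eqOn_zero_of_preconnected_of_eventuallyEq_zero hconv hmem ?_
    have : (-(1 / 2 : ℝ) * I : ℂ).im < 0 := by simp
    filter_upwards [(isOpen_lt continuous_im continuous_const).mem_nhds this] with w hw
    exact if_neg (not_le.2 hw)
  -- The identity theorem covers only the open sides and top; these edges are reached by continuity.
  have hfz : ∀ z ∈ Ioo (-r) r ×ℂ Ico 0 1, f z = 0 := by
    intro z hz
    have := hgz (show z ∈ U from ⟨hz.1, neg_one_lt_zero.trans_le hz.2.1, hz.2.2⟩)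
    rwa [show g z = f z from if_pos hz.2.1] at this
  have hcl : z ∈ closure (Ioo (-r) r ×ℂ Ico 0 1) := by
    rwa [closure_reProdIm, closure_Ico zero_ne_one, closure_Ioo (by linarith)]
  have hcz : ContinuousWithinAt f (Ioo (-r) r ×ℂ Ico 0 1) z :=
    (hc z hz).mono
      (reProdIm_subset_iff.2 (prod_mono Ioo_subset_Icc_self Ico_subset_Icc_self))
  have := hcz.mem_closure (t := {0}) hcl fun w hw => hfz w hw
  simpa using this

/-- A function on a strip which vanishes on the real line vanishes identically. -/
theorem eq_zero_of_real_eq_zero {f : ℂ → ℂ}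
    (hc : ContinuousOn f {z | 0 ≤ z.im ∧ z.im ≤ 1})
    (hd : DifferentiableOn ℂ f {z | 0 < z.im ∧ z.im < 1})
    (h0 : ∀ t : ℝ, f t = 0) {z : ℂ} (hz : 0 ≤ z.im ∧ z.im ≤ 1) : f z = 0 := by
  refine eq_zero_of_bottom_eq_zero (r := |z.re| + 1) (by positivity) (hc.mono fun w hw => hw.2)
    (hd.mono fun w hw => hw.2) (fun t _ => h0 t) ⟨?_, hz⟩
  constructor
  · have := neg_abs_le z.re
    linarith
  · have := le_abs_self z.re
    linarith

/-- A bounded function on a strip with the same values on both boundary lines is constant. -/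
theorem eq_of_periodic_of_bounded {f : ℂ → ℂ} {C : ℝ}
    (hc : ContinuousOn f {z | 0 ≤ z.im ∧ z.im ≤ 1})
    (hd : DifferentiableOn ℂ f {z | 0 < z.im ∧ z.im < 1})
    (hp : ∀ t : ℝ, f (t + I) = f t) (hb : ∀ z : ℂ, 0 ≤ z.im → z.im ≤ 1 → ‖f z‖ ≤ C) (t : ℝ) :
    f t = f 0 := by
  -- The i-periodic extension is continuous because the boundary values match, entire because the
  -- seams Im z ∈ ℤ are removable, and bounded, so Liouville's theorem applies.
  let g : ℂ → ℂ := fun z => f (z.re + (Int.fract z.im : ℝ) * I)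
  have hgc : Continuous g := by
    refine ContinuousOn.comp_fract (f := fun (z : ℂ) (v : ℝ) => f (z.re + v * I)) ?_ continuous_im
      fun z => by simp [hp]
    refine hc.comp (by fun_prop) ?_
    rintro ⟨z, v⟩ ⟨-, hv⟩
    simpa using hv
  have hg : ∀ (m : ℤ) (z : ℂ), (m : ℝ) < z.im → z.im < m + 1 → g =ᶠ[𝓝 z] fun w => f (w - m * I) := by
    intro m z h1 h2
    filter_upwards [(isOpen_lt continuous_const continuous_im).mem_nhds h1,
      (isOpen_lt continuous_im continuous_const).mem_nhds h2] with w (hw1 : (m : ℝ) < w.im) hw2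
    have hfl : ⌊w.im⌋ = m := Int.floor_eq_iff.2 ⟨hw1.le, hw2⟩
    change f _ = f _
    congr 1
    apply Complex.ext <;> simp [Int.fract, hfl]
  have hgd' : ∀ (m : ℤ) (z : ℂ), (m : ℝ) < z.im → z.im < m + 1 → DifferentiableAt ℂ g z := by
    intro m z h1 h2
    refine DifferentiableAt.congr_of_eventuallyEq ?_ (hg m z h1 h2)
    have : DifferentiableAt ℂ f (z - m * I) := by
      refine hd.differentiableAt (IsOpen.mem_nhds ?_ ?_)
      · exact (isOpen_lt continuous_const continuous_im).inter
          (isOpen_lt continuous_im continuous_const)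
      · constructor <;> simp <;> linarith
    exact DifferentiableAt.comp (f := fun w : ℂ => w - m * I) z this (by fun_prop)
  have hgd : Differentiable ℂ g := by
    intro z
    let m : ℤ := ⌊z.im⌋
    have hm1 : (m : ℝ) ≤ z.im := Int.floor_le _
    have hm2 : z.im < m + 1 := Int.lt_floor_add_one _
    let U : Set ℂ := {w | (m - 1 : ℝ) < w.im} ∩ {w | w.im < m + 1}
    have hU : IsOpen U := (isOpen_lt continuous_const continuous_im).inter
          (isOpen_lt continuous_im continuous_const)
    -- `z` may lie on the seam Im z = m, so the neighbourhood reaches one unit below it.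
    refine (differentiableOn_of_off_line hU m hgc.continuousOn fun w hw hwm => ?_).differentiableAt
      (hU.mem_nhds ⟨?_, hm2⟩)
    · rcases lt_or_gt_of_ne hwm with h | h
      · refine hgd' (m - 1) w ?_ ?_
        · push_cast; exact hw.1
        · push_cast; linarith
      · exact hgd' m w h hw.2
    · change (m - 1 : ℝ) < z.im
      linarith
  have hgb : Bornology.IsBounded (range g) := by
    refine (Metric.isBounded_closedBall (x := (0 : ℂ)) (r := C)).subset ?_
    rintro _ ⟨z, rfl⟩
    rw [mem_closedBall_zero_iff]
    exact hb _ (by simp) (by simpa using (Int.fract_lt_one _).le)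
  have := hgd.apply_eq_apply_of_bounded hgb t 0
  simpa [g] using this

end CuntzQN

end

noncomputable section

namespace CuntzQN

/-! ### Monomials -/

/-- The unitary `u` as an element of the unitary group. -/
def unitaryU : unitary QN := ⟨u, relations.unitary⟩

/-- The integral powers of the unitary `u`. -/
def U (k : ℤ) : QN := ((unitaryU ^ k : unitary QN) : QN)

theorem U_zero : U 0 = 1 := by simp [U]

theorem U_one : U 1 = u := by simp [U, unitaryU]

theorem U_add (k l : ℤ) : U (k + l) = U k * U l := by simp [U, zpow_add]

theorem star_U (k : ℤ) : star (U k) = U (-k) := by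
  rw [U, U, zpow_neg, ← Unitary.star_eq_inv, Unitary.coe_star]

theorem U_natCast (k : ℕ) : U k = u ^ k := by simp [U, unitaryU]

theorem U_mul_U_neg (k : ℤ) : U k * U (-k) = 1 := by rw [← U_add, add_neg_cancel, U_zero]

theorem U_neg_mul_U (k : ℤ) : U (-k) * U k = 1 := by rw [← U_add, neg_add_cancel, U_zero]

theorem s_mul_s (n m : ℕ+) : s n * s m = s (n * m) := relations.mul n m

theorem star_s_mul_s (n : ℕ+) : star (s n) * s n = 1 := relations.isometry n

theorem s_one : s 1 = 1 := by
  have h := s_mul_s 1 1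
  rw [mul_one] at h
  calc s 1 = (star (s 1) * s 1) * s 1 := by rw [star_s_mul_s, one_mul]
    _ = 1 := by rw [mul_assoc, h, star_s_mul_s]

theorem s_mul_U (n : ℕ+) (k : ℤ) : s n * U k = U (n * k) * s n := by
  have hnat : ∀ k : ℕ, s n * U k = U (n * k) * s n := by
    intro k
    induction k with
    | zero => simp [U_zero]
    | succ k ih =>
      have h1 : s n * U 1 = U n * s n := by
        rw [U_one, relations.semiconj, U_natCast]
      rw [Nat.cast_succ, U_add, ← mul_assoc, ih, mul_assoc, h1, ← mul_assoc, ← U_add, mul_add,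
        mul_one]
  obtain ⟨k, rfl | rfl⟩ := k.eq_nat_or_neg
  · exact hnat k
  · calc s n * U (-k) = U (n * (-k)) * (U (n * k) * s n) * U (-k) := by
          rw [← mul_assoc, ← U_add, mul_neg, neg_add_cancel, U_zero, one_mul]
      _ = U (n * (-k)) * s n := by rw [← hnat k, mul_assoc, mul_assoc, U_mul_U_neg, mul_one]

theorem U_mul_star_s (n : ℕ+) (k : ℤ) : U k * star (s n) = star (s n) * U (n * k) := by
  have := congrArg star (s_mul_U n (-k))
  simpa [star_mul, star_U] using this

theorem sum_U_e (n : ℕ+) :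
    ∑ k ∈ Finset.range (n : ℕ), U k * s n * (star (s n) * U (-k)) = 1 := by
  rw [← relations.sum_eq_one n]
  refine Finset.sum_congr rfl fun k _ => ?_
  rw [← U_natCast, star_U]
  simp only [mul_assoc]

theorem star_s_mul_U_mul_s_of_dvd (n : ℕ+) (k : ℤ) : star (s n) * U (n * k) * s n = U k := by
  rw [mul_assoc, ← s_mul_U, ← mul_assoc, star_s_mul_s, one_mul]

/-- Put x_j = s_n^* u^j s_n. Compressing the partition of unity by s_n^* · s_n gives ∑ x_j x_j^* = 1
over 0 ≤ j < n. The term j = 0 is already 1, so the other positive terms vanish. A general exponent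
is reduced mod n by moving multiples of n past s_n^*. -/
theorem star_s_mul_U_mul_s_of_not_dvd (n : ℕ+) (k : ℤ) (h : ¬ (n : ℤ) ∣ k) :
    star (s n) * U k * s n = 0 := by
  let _ := CStarAlgebra.spectralOrder QN
  have := CStarAlgebra.spectralOrderedRing QN
  have key : ∀ j : ℕ, j ∈ Finset.range (n : ℕ) → j ≠ 0 → star (s n) * U j * s n = 0 := by
    have h1 : ∑ j ∈ Finset.range (n : ℕ),
        (star (s n) * U j * s n) * star (star (s n) * U j * s n) = 1 := by
      have : star (s n) * (∑ k ∈ Finset.range (n : ℕ), U k * s n * (star (s n) * U (-k))) * s n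
          = 1 := by rw [sum_U_e, mul_one, star_s_mul_s]
      rw [← this, Finset.mul_sum, Finset.sum_mul]
      refine Finset.sum_congr rfl fun j _ => ?_
      simp only [star_mul, star_star, star_U, mul_assoc]
    have h0 : 0 ∈ Finset.range (n : ℕ) := by simp
    rw [← Finset.add_sum_erase _ _ h0] at h1
    simp only [Nat.cast_zero, U_zero, mul_one, star_s_mul_s, star_one, add_eq_left] at h1
    rw [Finset.sum_eq_zero_iff_of_nonneg fun j _ => mul_star_self_nonneg _] at h1
    intro j hj hj0
    exact CStarRing.mul_star_self_eq_zero_iff _ |>.1 (h1 j (Finset.mem_erase.2 ⟨hj0, hj⟩))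
  have hn : (0 : ℤ) < n := by exact_mod_cast n.pos
  have hr0 := Int.emod_nonneg k hn.ne'
  obtain ⟨r, hr⟩ := Int.eq_ofNat_of_zero_le hr0
  have hrn : k % n < n := Int.emod_lt_of_pos k hn
  have hk : k = n * (k / n) + r := by rw [← hr, Int.mul_ediv_add_emod]
  rw [hk, U_add, ← mul_assoc, ← U_mul_star_s, mul_assoc, mul_assoc, ← mul_assoc (star (s n)),
    key r _ _, mul_zero]
  · rw [Finset.mem_range]; omega
  · rintro rfl
    exact h (Int.dvd_of_emod_eq_zero (by simpa using hr))

theorem star_s_mul_U_mul_s (n : ℕ+) (k : ℤ) :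
    star (s n) * U k * s n = if (n : ℤ) ∣ k then U (k / n) else 0 := by
  split_ifs with h
  · obtain ⟨l, rfl⟩ := h
    rw [star_s_mul_U_mul_s_of_dvd, Int.mul_ediv_cancel_left _ (by simp)]
  · exact star_s_mul_U_mul_s_of_not_dvd n k h

/-- The monomials `u ^ i * s a * (s b)⋆ * u ^ j`, which span a dense subalgebra. -/
def monomial (i : ℤ) (a b : ℕ+) (j : ℤ) : QN := U i * s a * star (s b) * U j

theorem U_mul_monomial (k i : ℤ) (a b : ℕ+) (j : ℤ) :
    U k * monomial i a b j = monomial (k + i) a b j := by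
  simp only [monomial, U_add, mul_assoc]

theorem monomial_mul_U (i : ℤ) (a b : ℕ+) (j k : ℤ) :
    monomial i a b j * U k = monomial i a b (j + k) := by
  simp only [monomial, U_add, mul_assoc]

theorem s_mul_monomial (c : ℕ+) (i : ℤ) (a b : ℕ+) (j : ℤ) :
    s c * monomial i a b j = monomial (c * i) (c * a) b j := by
  simp only [monomial, ← mul_assoc, s_mul_U]
  rw [mul_assoc _ (s c), s_mul_s]

theorem monomial_mul_star_s (i : ℤ) (a b : ℕ+) (j : ℤ) (c : ℕ+) :
    monomial i a b j * star (s c) = monomial i a (c * b) (c * j) := by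
  simp only [monomial, mul_assoc, U_mul_star_s]
  rw [← mul_assoc (star (s b)), ← star_mul, s_mul_s]

theorem star_monomial (i : ℤ) (a b : ℕ+) (j : ℤ) :
    star (monomial i a b j) = monomial (-j) b a (-i) := by
  simp [monomial, star_mul, star_U, mul_assoc]

theorem monomial_one : monomial 0 1 1 0 = 1 := by simp [monomial, U_zero, s_one]

theorem monomial_eq_U (k : ℤ) : monomial k 1 1 0 = U k := by simp [monomial, U_zero, s_one]

theorem monomial_eq_s (n : ℕ+) : monomial 0 n 1 0 = s n := by simp [monomial, U_zero, s_one]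

theorem monomial_eq_e (n : ℕ+) : monomial 0 n n 0 = e n := by simp [monomial, U_zero, e]

/-- The linear span of the monomials. -/
def monomialSpan : Submodule ℂ QN :=
  Submodule.span ℂ (Set.range fun p : ℤ × ℕ+ × ℕ+ × ℤ => monomial p.1 p.2.1 p.2.2.1 p.2.2.2)

theorem monomial_mem (i : ℤ) (a b : ℕ+) (j : ℤ) : monomial i a b j ∈ monomialSpan :=
  Submodule.subset_span ⟨(i, a, b, j), rfl⟩

theorem monomialSpan_induction {p : QN → Prop} (h0 : p 0) (hadd : ∀ x y, p x → p y → p (x + y))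
    (hsmul : ∀ (c : ℂ) x, p x → p (c • x)) (hm : ∀ i a b j, p (monomial i a b j))
    {x : QN} (hx : x ∈ monomialSpan) : p x := by
  induction hx using Submodule.span_induction with
  | mem x hx => obtain ⟨q, rfl⟩ := hx; exact hm _ _ _ _
  | zero => exact h0
  | add x y _ _ hx hy => exact hadd x y hx hy
  | smul c x _ hx => exact hsmul c x hx

theorem mul_monomial_mem {x : QN} (i : ℤ) (a b : ℕ+) (j : ℤ) (hx : x ∈ monomialSpan) :
    U i * s a * x * star (s b) * U j ∈ monomialSpan := by
  refine monomialSpan_induction (p := fun x => U i * s a * x * star (s b) * U j ∈ monomialSpan)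
    ?_ ?_ ?_ ?_ hx
  · simp
  · intro x y hx hy
    simpa only [mul_add, add_mul] using add_mem hx hy
  · intro c x hx
    simpa only [mul_smul_comm, smul_mul_assoc] using monomialSpan.smul_mem c hx
  · intro k c d l
    rw [mul_assoc (U i), s_mul_monomial, U_mul_monomial, monomial_mul_star_s, monomial_mul_U]
    exact monomial_mem _ _ _ _

/-- This is what closes the monomial span under products. Inserting the partition of unity of level
b on the right and using s_c u^j s_b = u^{cj} s_b s_c produces the compressions s_b^* u^{y+cj} s_b,
each of which is a power of u or 0. -/
theorem star_s_mul_U_mul_s_mem (b c : ℕ+) (y : ℤ) :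
    star (s b) * U y * s c ∈ monomialSpan := by
  have h : star (s b) * U y * s c = ∑ j ∈ Finset.range (b : ℕ),
      (star (s b) * U (y + c * j) * s b) * s c * star (s b) * U (-j) := by
    rw [← mul_one (star (s b) * U y * s c), ← sum_U_e b, Finset.mul_sum]
    refine Finset.sum_congr rfl fun j _ => ?_
    simp only [← mul_assoc]
    rw [mul_assoc _ (s c) (U j), s_mul_U, ← mul_assoc, mul_assoc _ (s c) (s b), s_mul_s,
      mul_comm c b, ← s_mul_s, U_add]
    simp only [mul_assoc]
  rw [h]
  refine sum_mem fun j _ => ?_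
  rw [star_s_mul_U_mul_s]
  split_ifs
  · exact monomial_mem _ _ _ _
  · simp

theorem mul_mem_monomialSpan {x y : QN} (hx : x ∈ monomialSpan) (hy : y ∈ monomialSpan) :
    x * y ∈ monomialSpan := by
  refine monomialSpan_induction (p := fun x => x * y ∈ monomialSpan) ?_ ?_ ?_ ?_ hx
  · simp
  · intro x x' hx hx'
    simpa only [add_mul] using add_mem hx hx'
  · intro c x hx
    simpa only [smul_mul_assoc] using monomialSpan.smul_mem c hx
  intro i a b j
  refine monomialSpan_induction (p := fun y => monomial i a b j * y ∈ monomialSpan)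
    ?_ ?_ ?_ ?_ hy
  · simp
  · intro x x' hx hx'
    simpa only [mul_add] using add_mem hx hx'
  · intro c x hx
    simpa only [mul_smul_comm] using monomialSpan.smul_mem c hx
  intro k c d l
  have := mul_monomial_mem i a d l (star_s_mul_U_mul_s_mem b c (j + k))
  simpa only [monomial, U_add, mul_assoc] using this

theorem star_mem_monomialSpan {x : QN} (hx : x ∈ monomialSpan) : star x ∈ monomialSpan := by
  refine monomialSpan_induction (p := fun x => star x ∈ monomialSpan) ?_ ?_ ?_ ?_ hx
  · simp
  · intro x y hx hy
    simpa only [star_add] using add_mem hx hy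
  · intro c x hx
    simpa only [star_smul] using monomialSpan.smul_mem _ hx
  · intro i a b j
    rw [star_monomial]
    exact monomial_mem _ _ _ _

/-- The `⋆`-algebra spanned by the monomials. -/
def monomialAlgebra : StarSubalgebra ℂ QN where
  carrier := monomialSpan
  mul_mem' := mul_mem_monomialSpan
  one_mem' := monomial_one ▸ monomial_mem _ _ _ _
  add_mem' := add_mem
  zero_mem' := zero_mem _
  algebraMap_mem' r := by
    rw [Algebra.algebraMap_eq_smul_one]
    exact monomialSpan.smul_mem r (monomial_one ▸ monomial_mem _ _ _ _)
  star_mem' := star_mem_monomialSpan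

theorem dense_monomialSpan : Dense (monomialSpan : Set QN) := fun x =>
  mem_of_closed monomialAlgebra.topologicalClosure monomialAlgebra.isClosed_topologicalClosure
    (monomialAlgebra.le_topologicalClosure (U_one ▸ monomial_eq_U 1 ▸ monomial_mem _ _ _ _))
    (fun n => monomialAlgebra.le_topologicalClosure (monomial_eq_s n ▸ monomial_mem _ _ _ _)) x

/-- A closed linear condition holds everywhere if it holds for monomials. -/
theorem monomial_induction {p : QN → Prop} (hadd : ∀ x y, p x → p y → p (x + y))
    (hsmul : ∀ (c : ℂ) x, p x → p (c • x)) (hm : ∀ i a b j, p (monomial i a b j))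
    (hcl : IsClosed {x | p x}) (x : QN) : p x := by
  refine hcl.closure_subset_iff.2 (fun y hy => ?_) (dense_monomialSpan x)
  refine monomialSpan_induction ?_ hadd hsmul hm hy
  simpa using hsmul 0 _ (hm 0 1 1 0)

theorem gauge_monomial (t : Torus) (i : ℤ) (a b : ℕ+) (j : ℤ) :
    gauge t (monomial i a b j) = ((weight t a : ℂ) * star (weight t b : ℂ)) • monomial i a b j := by
  have hU : ∀ k, gauge t (U k) = U k := by
    have hn : ∀ k : ℕ, gauge t (U k) = U k := fun k => by rw [U_natCast, map_pow, gauge_u]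
    intro k
    obtain ⟨k, rfl | rfl⟩ := k.eq_nat_or_neg
    · exact hn k
    · rw [← star_U, map_star, hn]
  simp only [monomial, map_mul, map_star, gauge_s, hU, star_smul, mul_smul_comm, smul_mul_assoc,
    smul_smul]
  congr 1
  ring

end CuntzQN

end

noncomputable section

namespace CuntzQN

/-! ### States -/

section States

variable {A : Type*} [CStarAlgebra A]

open scoped ComplexOrder

theorem IsState.nonneg {τ : A →ₗ[ℂ] ℂ} (h : IsState τ) (x : A) : 0 ≤ τ (star x * x) := by
  obtain ⟨r, hr, hx⟩ := h.2 x
  rw [hx]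
  exact_mod_cast hr

/-- A state as a positive linear functional. -/
def IsState.toPositiveLinearMap [PartialOrder A] [StarOrderedRing A] {τ : A →ₗ[ℂ] ℂ}
    (h : IsState τ) : A →ₚ[ℂ] ℂ :=
  PositiveLinearMap.mk₀ τ fun x hx => by
    obtain ⟨y, rfl⟩ := CStarAlgebra.nonneg_iff_eq_star_mul_self.1 hx
    exact h.nonneg y

theorem IsState.continuous {τ : A →ₗ[ℂ] ℂ} (h : IsState τ) : Continuous τ := by
  let _ := CStarAlgebra.spectralOrder A
  have := CStarAlgebra.spectralOrderedRing A
  exact map_continuous h.toPositiveLinearMap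

theorem IsState.exists_bound {τ : A →ₗ[ℂ] ℂ} (h : IsState τ) : ∃ C, 0 < C ∧ ∀ x, ‖τ x‖ ≤ C * ‖x‖ :=
  (⟨τ, h.continuous⟩ : A →L[ℂ] ℂ).bound

theorem IsState.map_star {τ : A →ₗ[ℂ] ℂ} (h : IsState τ) (x : A) : τ (star x) = star (τ x) := by
  let _ := CStarAlgebra.spectralOrder A
  have := CStarAlgebra.spectralOrderedRing A
  exact StarHomClass.map_star h.toPositiveLinearMap x

/-- The Cauchy–Schwarz inequality of the pre-GNS inner product. -/
theorem IsState.cauchy_schwarz {τ : A →ₗ[ℂ] ℂ} (h : IsState τ) (x y : A) :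
    ‖τ (star x * y)‖ ^ 2 ≤ (τ (star x * x)).re * (τ (star y * y)).re := by
  let _ := CStarAlgebra.spectralOrder A
  have := CStarAlgebra.spectralOrderedRing A
  let f := h.toPositiveLinearMap
  have h1 := norm_inner_le_norm (𝕜 := ℂ) (f.toPreGNS x) (f.toPreGNS y)
  rw [PositiveLinearMap.preGNS_inner_def] at h1
  have h2 := pow_le_pow_left₀ (norm_nonneg _) h1 2
  rw [mul_pow] at h2
  have h3 : ∀ z : A, ‖f.toPreGNS z‖ ^ 2 = (τ (star z * z)).re := fun z => by
    have := congrArg Complex.re (f.preGNS_norm_sq (f.toPreGNS z))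
    rw [← Complex.ofReal_pow, Complex.ofReal_re] at this
    exact this
  rw [h3, h3] at h2
  exact h2

theorem IsState.apply_mul_eq_zero {τ : A →ₗ[ℂ] ℂ} (h : IsState τ) {y : A}
    (hy : τ (star y * y) = 0) (x : A) : τ (x * y) = 0 := by
  have := h.cauchy_schwarz (star x) y
  rw [hy, star_star, Complex.zero_re, mul_zero] at this
  have := pow_eq_zero_iff two_ne_zero |>.1 (le_antisymm this (sq_nonneg _))
  exact norm_eq_zero.1 this

end States

/-! ### Central states -/

/-- States of `Q_ℕ` which have `u` and the projections `e n` in their centralizer. -/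
structure IsCentral (σ : QN →ₗ[ℂ] ℂ) : Prop where
  state : IsState σ
  u_mul : ∀ x, σ (u * x) = σ (x * u)
  e_mul : ∀ n x, σ (e n * x) = σ (x * e n)

namespace IsCentral

variable {σ : QN →ₗ[ℂ] ℂ} (h : IsCentral σ)

include h

theorem U_mul (k : ℤ) (x : QN) : σ (U k * x) = σ (x * U k) := by
  have hn : ∀ (k : ℕ) (x : QN), σ (U k * x) = σ (x * U k) := by
    intro k
    induction k with
    | zero => intro x; simp [U_zero]
    | succ k ih =>
      intro x
      rw [Nat.cast_succ, U_add, mul_assoc, ih, U_one, mul_assoc, h.u_mul, ← U_one, mul_assoc,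
        ← U_add, add_comm]
  obtain ⟨k, rfl | rfl⟩ := k.eq_nat_or_neg
  · exact hn k x
  · have := hn k (U (-k) * x * U (-k))
    rw [← mul_assoc, ← mul_assoc, U_mul_U_neg, one_mul, mul_assoc _ _ (U k), U_neg_mul_U,
      mul_one] at this
    exact this.symm

/-- The n summands u^k u^j e_n u^{-j} of u^k have equal values, since powers of u are in the
centralizer. -/
theorem U_mul_e (n : ℕ+) (k : ℤ) : σ (U k) = n * σ (U k * e n) := by
  conv_lhs => rw [← mul_one (U k), ← sum_U_e n, Finset.mul_sum, map_sum]
  have : ∀ j ∈ Finset.range (n : ℕ), σ (U k * (U j * s n * (star (s n) * U (-j)))) =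
      σ (U k * e n) := by
    intro j _
    rw [show U k * (U j * s n * (star (s n) * U (-j))) = U j * (U k * e n * U (-j)) by
      simp only [← mul_assoc, e]
      rw [← U_add, add_comm, U_add], h.U_mul, mul_assoc, U_neg_mul_U, mul_one]
  rw [Finset.sum_congr rfl this]
  simp

/-- For k ≠ 0 the integer m = |k| + 1 does not divide k, so e_m u^k e_m = 0, while centrality gives
σ(u^k) = m σ(e_m u^k e_m). -/
theorem apply_U (k : ℤ) : σ (U k) = if k = 0 then 1 else 0 := by
  split_ifs with hk
  · rw [hk, U_zero, h.state.1]
  let m : ℕ+ := ⟨k.natAbs + 1, Nat.succ_pos _⟩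
  have hm : ¬ ((m : ℕ) : ℤ) ∣ k := by
    intro hd
    have := Int.natAbs_dvd_natAbs.2 hd
    have := Nat.le_of_dvd (Int.natAbs_pos.2 hk) this
    change k.natAbs + 1 ≤ k.natAbs at this
    omega
  have he : e m = e m * e m := by
    simp only [e]
    rw [mul_assoc, ← mul_assoc (star (s m)), star_s_mul_s, one_mul]
  rw [h.U_mul_e m, he, ← mul_assoc, ← h.e_mul]
  have : e m * (U k * e m) = s m * (star (s m) * U k * s m) * star (s m) := by
    simp only [e, mul_assoc]
  rw [this, star_s_mul_U_mul_s_of_not_dvd m k hm]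
  simp

/-- A factor u^b on the right of w = u^i s_a s_b^* u^j can be absorbed as u^a on its left, or
carried to the left by centrality. Hence σ(u^{(b-a)r} w) = σ(w) for all r. The powers u^{(b-a)r} are
orthonormal for σ, and Bessel's inequality gives R |σ(w)|² ≤ σ(w^* w) for every R. -/
theorem apply_monomial_of_ne (i : ℤ) {a b : ℕ+} (j : ℤ) (hab : a ≠ b) :
    σ (monomial i a b j) = 0 := by
  have hstep : ∀ i, σ (monomial (b - a + i) a b j) = σ (monomial i a b j) := by
    intro i
    have h1 : monomial (i - a) a b j * U b = monomial i a b j := by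
      rw [monomial_mul_U, add_comm, monomial, U_add, ← mul_assoc, mul_assoc (U (i - a) * s a)]
      have : star (s b) * U b = U 1 * star (s b) := by rw [U_mul_star_s, mul_one]
      rw [this, ← mul_assoc, mul_assoc _ (s a), s_mul_U, mul_one, ← mul_assoc, ← U_add,
        sub_add_cancel]
      rfl
    rw [← h1, ← h.U_mul, U_mul_monomial]
    congr 2
    ring
  have hstep' : ∀ r : ℕ, σ (U ((b - a) * r) * monomial i a b j) = σ (monomial i a b j) := by
    intro r
    rw [U_mul_monomial]
    induction r with
    | zero => simp
    | succ r ih =>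
      rw [← ih, ← hstep ((b - a) * r + i)]
      congr 2
      push_cast
      ring
  set w := monomial i a b j
  have hc : (b - a : ℤ) ≠ 0 := by
    rw [sub_ne_zero]
    exact_mod_cast hab.symm
  have hbound : ∀ R : ℕ, R * ‖σ w‖ ^ 2 ≤ (σ (star w * w)).re := by
    intro R
    rcases Nat.eq_zero_or_pos R with rfl | hR
    · simpa using (Complex.nonneg_iff.1 (h.state.nonneg w)).1
    have hcs := h.state.cauchy_schwarz (∑ r ∈ Finset.range R, U (-((b - a) * r))) w
    have h1 : σ (star (∑ r ∈ Finset.range R, U (-((b - a) * r : ℤ))) * w) = R * σ w := by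
      rw [star_sum, Finset.sum_mul, map_sum]
      simp only [star_U, neg_neg, hstep']
      simp
    have h2 : σ (star (∑ r ∈ Finset.range R, U (-((b - a) * r : ℤ))) *
        ∑ r ∈ Finset.range R, U (-((b - a) * r : ℤ))) = R := by
      rw [star_sum, Finset.sum_mul_sum, map_sum]
      simp only [map_sum, star_U, neg_neg, ← U_add, h.apply_U, add_neg_eq_zero, mul_right_inj' hc,
        Nat.cast_inj]
      have : ∀ r ∈ Finset.range R, (∑ r' ∈ Finset.range R, if r = r' then (1 : ℂ) else 0) = 1 := by
        intro r hr
        rw [Finset.sum_ite_eq, if_pos hr]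
      rw [Finset.sum_congr rfl this]
      simp
    rw [h1, h2, norm_mul, mul_pow, Complex.norm_natCast, Complex.natCast_re] at hcs
    have hR' : (0 : ℝ) < R := by exact_mod_cast hR
    refine le_of_mul_le_mul_left ?_ hR'
    linarith
  by_contra hne
  have hpos : 0 < ‖σ w‖ ^ 2 := by positivity
  obtain ⟨R, hR⟩ := exists_nat_gt ((σ (star w * w)).re / ‖σ w‖ ^ 2)
  rw [div_lt_iff₀ hpos] at hR
  exact absurd (hbound R) (not_le.2 hR)

theorem apply_monomial (i : ℤ) (a b : ℕ+) (j : ℤ) :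
    σ (monomial i a b j) = if a = b ∧ i + j = 0 then (1 / a : ℂ) else 0 := by
  by_cases hab : a = b
  · subst hab
    have h1 : σ (monomial i a a j) = σ (U (i + j) * e a) := by
      rw [monomial, ← h.U_mul, e, mul_assoc (U i), ← mul_assoc, ← U_add, add_comm]
    have h2 := h.U_mul_e a (i + j)
    rw [h.apply_U] at h2
    have ha : (a : ℂ) ≠ 0 := by exact_mod_cast a.ne_zero
    rw [h1, ← mul_right_inj' ha, ← h2]
    simp [ha]
  · rw [h.apply_monomial_of_ne i j hab, if_neg fun h => hab h.1]

theorem eq {σ' : QN →ₗ[ℂ] ℂ} (h' : IsCentral σ') : σ = σ' := by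
  refine LinearMap.ext fun x => ?_
  refine monomial_induction (p := fun x => σ x = σ' x) ?_ ?_ ?_ ?_ x
  · intro x y hx hy
    rw [map_add, map_add, hx, hy]
  · intro c x hx
    rw [map_smul, map_smul, hx]
  · intro i a b j
    rw [h.apply_monomial, h'.apply_monomial]
  · exact isClosed_eq h.state.continuous h'.state.continuous

end IsCentral

end CuntzQN

end

noncomputable section

namespace CuntzQN

/-! ### The gauge action and the expectation -/

open MeasureTheory

instance : PartialOrder QN := CStarAlgebra.spectralOrder QN

instance : StarOrderedRing QN := CStarAlgebra.spectralOrderedRing QN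

instance : IsProbabilityMeasure torusHaar :=
  ⟨Measure.haarMeasure_self (K₀ := (⊤ : TopologicalSpace.PositiveCompacts Torus))⟩

instance : torusHaar.IsMulLeftInvariant :=
  inferInstanceAs (Measure.haarMeasure ⊤).IsMulLeftInvariant

instance : torusHaar.IsOpenPosMeasure :=
  inferInstanceAs (Measure.haarMeasure ⊤).IsOpenPosMeasure

theorem norm_hom_apply_le {A B : Type*} [CStarAlgebra A] [CStarAlgebra B] (φ : A →⋆ₐ[ℂ] B) (x : A) :
    ‖φ x‖ ≤ ‖x‖ := NonUnitalStarAlgHom.norm_apply_le φ x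

theorem continuous_weight (n : ℕ+) : Continuous fun t => weight t n := by
  have hfin : ((fun p : Nat.Primes => (p : ℕ)) ⁻¹' ((n : ℕ).factorization.support : Set ℕ)).Finite :=
    ((n : ℕ).factorization.support.finite_toSet).preimage Nat.Primes.coe_nat_injective.injOn
  have : (fun t => weight t n) =
      fun t : Torus => ∏ p ∈ hfin.toFinset, t p ^ (n : ℕ).factorization p := by
    funext t
    refine finprod_eq_prod_of_mulSupport_subset _ fun p hp => ?_
    simp only [Set.Finite.coe_toFinset, Set.mem_preimage, Finset.mem_coe, Finsupp.mem_support_iff]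
    intro h0
    exact hp (by simp [h0])
  rw [this]
  fun_prop

theorem weight_mulSingle (p : Nat.Primes) (z : Circle) (n : ℕ+) :
    weight (Pi.mulSingle p z) n = z ^ (n : ℕ).factorization p := by
  rw [weight, finprod_eq_single _ p, Pi.mulSingle_eq_same]
  intro q hq
  rw [Pi.mulSingle_eq_of_ne hq, one_pow]

theorem weight_mul_left (t t' : Torus) (n : ℕ+) :
    weight (t * t') n = weight t n * weight t' n := by
  unfold weight
  rw [← finprod_mul_distrib (weight_finite t n) (weight_finite t' n)]
  exact finprod_congr fun p => by rw [Pi.mul_apply, mul_pow]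

/-- Clear on monomials; the general case is a uniform limit, since every `gauge t` is contractive.
-/
theorem continuous_gauge (x : QN) : Continuous fun t => gauge t x := by
  refine continuous_of_uniform_approx_of_continuous fun v hv => ?_
  obtain ⟨ε, hε, hv⟩ := Metric.mem_uniformity_dist.1 hv
  obtain ⟨y, hy, hxy⟩ := Metric.mem_closure_iff.1 (dense_monomialSpan x) ε hε
  refine ⟨fun t => gauge t y, ?_, fun t => hv ?_⟩
  · refine monomialSpan_induction (p := fun y => Continuous fun t => gauge t y) ?_ ?_ ?_ ?_ hy
    · simpa using continuous_const
    · intro x y hx hy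
      simp only [map_add]
      exact hx.add hy
    · intro c x hx
      simp only [map_smul]
      exact hx.const_smul c
    · intro i a b j
      simp only [gauge_monomial]
      have ha := continuous_weight a
      have hb := continuous_weight b
      fun_prop
  · rw [dist_eq_norm, ← map_sub]
    rw [dist_eq_norm] at hxy
    exact (norm_hom_apply_le _ _).trans_lt hxy

theorem integrable_gauge (x : QN) : Integrable (fun t => gauge t x) torusHaar :=
  (continuous_gauge x).integrable_of_hasCompactSupport (HasCompactSupport.of_compactSpace _)

/-- The expectation as a continuous linear map. -/
def expectationL : QN →L[ℂ] QN :=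
  LinearMap.mkContinuous
    { toFun := expectation
      map_add' := fun x y => by
        simp only [expectation, map_add]
        exact integral_add (integrable_gauge x) (integrable_gauge y)
      map_smul' := fun c x => by
        simp only [expectation, map_smul]
        exact integral_smul _ _ } 1 fun x => by
      have : ‖∫ t, gauge t x ∂torusHaar‖ ≤ ‖x‖ * torusHaar.real Set.univ :=
        norm_integral_le_of_norm_le_const (Filter.Eventually.of_forall fun t =>
          norm_hom_apply_le (gauge t) x)
      simpa [expectation] using this

theorem expectationL_apply (x : QN) : expectationL x = expectation x := rfl

/-- Take a prime p at which the exponents of a and b differ by k ≠ 0, and rotate that coordinate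
alone by the angle π/k. The value −1 makes the averaged integral equal to its own negative. -/
theorem exists_weight_ne {a b : ℕ+} (hab : a ≠ b) :
    ∃ t : Torus, (weight t a : ℂ) * star (weight t b : ℂ) = -1 := by
  have hne : (a : ℕ).factorization ≠ (b : ℕ).factorization := fun h =>
    hab (PNat.eq (Nat.factorization_inj a.ne_zero b.ne_zero h))
  obtain ⟨p, hp⟩ := DFunLike.ne_iff.1 hne
  have hpp : p.Prime := by
    by_contra h
    exact hp (by simp [Nat.factorization_eq_zero_of_not_prime _ h])
  let k : ℝ := (a : ℕ).factorization p - (b : ℕ).factorization p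
  have hk : k ≠ 0 := by
    rw [sub_ne_zero]
    exact_mod_cast hp
  let q : Nat.Primes := ⟨p, hpp⟩
  refine ⟨Pi.mulSingle q (Circle.exp (Real.pi / k)), ?_⟩
  rw [weight_mulSingle, weight_mulSingle, Complex.star_def, ← Circle.coe_inv_eq_conj,
    ← Circle.exp_natCast_mul, ← Circle.exp_natCast_mul, ← Circle.coe_mul, ← Circle.exp_neg,
    ← Circle.exp_add]
  have : ((a : ℕ).factorization p : ℝ) * (Real.pi / k) + -((b : ℕ).factorization p * (Real.pi / k))
      = Real.pi := by
    field_simp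
    simp [k, sub_eq_add_neg]
  change ((Circle.exp (((a : ℕ).factorization p : ℝ) * (Real.pi / k) +
    -((b : ℕ).factorization p * (Real.pi / k))) : Circle) : ℂ) = -1
  rw [this]
  simp

theorem expectation_monomial (i : ℤ) (a b : ℕ+) (j : ℤ) :
    expectation (monomial i a b j) = if a = b then monomial i a b j else 0 := by
  rw [expectation]
  simp only [gauge_monomial]
  split_ifs with hab
  · subst hab
    have : ∀ t, (weight t a : ℂ) * star (weight t a : ℂ) = 1 := fun t => by
      rw [mul_comm, star_circle_mul]
    simp only [this, one_smul, integral_const, probReal_univ]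
  · obtain ⟨t₀, ht₀⟩ := exists_weight_ne hab
    have h := integral_mul_left_eq_self (μ := torusHaar)
      (fun t => ((weight t a : ℂ) * star (weight t b : ℂ)) • monomial i a b j) t₀
    have h1 : ∀ t, ((weight (t₀ * t) a : ℂ) * star (weight (t₀ * t) b : ℂ)) • monomial i a b j =
        -(((weight t a : ℂ) * star (weight t b : ℂ)) • monomial i a b j) := by
      intro t
      rw [weight_mul_left, weight_mul_left, ← neg_smul]
      congr 1
      rw [Circle.coe_mul, Circle.coe_mul, star_mul]
      linear_combination (weight t a : ℂ) * star (weight t b : ℂ) * ht₀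
    simp only [h1] at h
    rw [integral_neg] at h
    have h2 := eq_neg_iff_add_eq_zero.1 h.symm
    rw [← two_smul ℂ] at h2
    exact (smul_eq_zero.1 h2).resolve_left two_ne_zero

theorem isClosed_F : IsClosed (F : Set QN) := StarSubalgebra.isClosed_topologicalClosure _

theorem e_mem_F (n : ℕ+) : e n ∈ F :=
  StarSubalgebra.le_topologicalClosure _
    (StarAlgebra.subset_adjoin ℂ _ (Set.mem_insert_of_mem _ ⟨n, rfl⟩))

theorem u_mem_F : u ∈ F :=
  StarSubalgebra.le_topologicalClosure _ (StarAlgebra.subset_adjoin ℂ _ (Set.mem_insert _ _))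

theorem U_mem_F (k : ℤ) : U k ∈ F := by
  have hn : ∀ k : ℕ, U k ∈ F := fun k => by
    rw [U_natCast]
    exact pow_mem u_mem_F k
  obtain ⟨k, rfl | rfl⟩ := k.eq_nat_or_neg
  · exact hn k
  · rw [← star_U]
    exact star_mem (hn k)

theorem monomial_mem_F (i : ℤ) (a : ℕ+) (j : ℤ) : monomial i a a j ∈ F := by
  rw [monomial, mul_assoc (U i)]
  exact mul_mem (mul_mem (U_mem_F i) (e_mem_F a)) (U_mem_F j)

/-- Closed `⋆`-subalgebras containing `u` and the projections `e n` contain `F`. -/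
theorem F_le {S : StarSubalgebra ℂ QN} (hS : IsClosed (S : Set QN)) (hu : u ∈ S)
    (he : ∀ n, e n ∈ S) : F ≤ S := by
  refine StarSubalgebra.topologicalClosure_minimal (StarAlgebra.adjoin_le ?_) hS
  rintro _ (rfl | ⟨n, rfl⟩)
  exacts [hu, he n]

theorem expectation_mem_F (x : QN) : expectation x ∈ F := by
  refine monomial_induction (p := fun x => expectationL x ∈ F) ?_ ?_ ?_ ?_ x
  · intro x y hx hy
    rw [map_add]
    exact add_mem hx hy
  · intro c x hx
    rw [map_smul]
    exact F.smul_mem hx c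
  · intro i a b j
    rw [expectationL_apply, expectation_monomial]
    split_ifs with hab
    · subst hab
      exact monomial_mem_F i a j
    · exact zero_mem F
  · exact isClosed_F.preimage expectationL.continuous

theorem gauge_e (t : Torus) (n : ℕ+) : gauge t (e n) = e n := by
  rw [e, map_mul, map_star, gauge_s, star_smul, smul_mul_smul_comm, mul_comm, star_circle_mul,
    one_smul]

theorem gauge_of_mem_F (t : Torus) {x : QN} (hx : x ∈ F) : gauge t x = x := by
  have : F ≤ StarAlgHom.equalizer (gauge t) (StarAlgHom.id ℂ QN) :=
    F_le (isClosed_eq (map_continuous (gauge t)) continuous_id) (gauge_u t) (gauge_e t)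
  exact this hx

theorem expectation_of_mem_F {x : QN} (hx : x ∈ F) : expectation x = x := by
  simp [expectation, gauge_of_mem_F _ hx]

theorem expectation_mul_left {y : QN} (hy : y ∈ F) (x : QN) :
    expectation (y * x) = y * expectation x := by
  simp only [expectation, map_mul, gauge_of_mem_F _ hy]
  exact integral_const_mul_of_integrable (integrable_gauge x)

theorem expectation_mul_right {y : QN} (hy : y ∈ F) (x : QN) :
    expectation (x * y) = expectation x * y := by
  simp only [expectation, map_mul, gauge_of_mem_F _ hy]
  exact integral_mul_const_of_integrable (integrable_gauge x)

theorem expectation_nonneg {x : QN} (hx : 0 ≤ x) : 0 ≤ expectation x :=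
  integral_nonneg fun t => map_nonneg (gauge t) hx

/-- The square root is obtained by functional calculus inside the closed subalgebra F. It is needed
because positivity of a functional on F is tested on squares of elements of F. -/
theorem exists_star_mul_self_of_mem_F {x : QN} (hx : 0 ≤ x) (hF : x ∈ F) :
    ∃ y ∈ F, star y * y = x := by
  have := isClosed_F
  refine ⟨cfc Real.sqrt x, cfc_mem (𝕜' := ℂ) (s := F) _ hF, ?_⟩
  have hsa : IsSelfAdjoint (cfc Real.sqrt x) := cfc_predicate _ _
  rw [hsa.star_eq, ← cfc_mul Real.sqrt Real.sqrt x]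
  conv_rhs => rw [← cfc_id ℝ x]
  refine cfc_congr fun r hr => ?_
  exact Real.mul_self_sqrt (spectrum_nonneg_of_nonneg hx hr)

/-- The extension of a linear functional on `F` by means of the expectation. -/
def extend (σ : F →ₗ[ℂ] ℂ) : QN →ₗ[ℂ] ℂ :=
  σ ∘ₗ (expectationL : QN →ₗ[ℂ] QN).codRestrict F.toSubalgebra.toSubmodule expectation_mem_F

theorem extend_apply (σ : F →ₗ[ℂ] ℂ) (x : QN) :
    extend σ x = σ ⟨expectation x, expectation_mem_F x⟩ := rfl

/-- E is unital, positive and an F-bimodule map, so the trace property on F becomes centrality on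
Q_ℕ. -/
theorem isCentral_extend {σ : F →ₗ[ℂ] ℂ} (h : IsTracialState σ) : IsCentral (extend σ) where
  state := by
    refine ⟨?_, fun x => ?_⟩
    · rw [extend_apply, ← h.1.1]
      congr 1
      exact Subtype.ext (expectation_of_mem_F (one_mem F))
    · obtain ⟨y, hy, hyx⟩ := exists_star_mul_self_of_mem_F
        (expectation_nonneg (star_mul_self_nonneg x)) (expectation_mem_F _)
      obtain ⟨r, hr, hr'⟩ := h.1.2 ⟨y, hy⟩
      refine ⟨r, hr, ?_⟩
      rw [extend_apply, ← hr']
      congr 1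
      exact Subtype.ext hyx.symm
  u_mul x := by
    have := h.2 ⟨u, u_mem_F⟩ ⟨expectation x, expectation_mem_F x⟩
    rw [extend_apply, extend_apply]
    convert this using 2
    · exact Subtype.ext (expectation_mul_left u_mem_F x)
    · exact Subtype.ext (expectation_mul_right u_mem_F x)
  e_mul n x := by
    have := h.2 ⟨e n, e_mem_F n⟩ ⟨expectation x, expectation_mem_F x⟩
    rw [extend_apply, extend_apply]
    convert this using 2
    · exact Subtype.ext (expectation_mul_left (e_mem_F n) x)
    · exact Subtype.ext (expectation_mul_right (e_mem_F n) x)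

/-! ### Gauge invariance of central states and the trace on F. -/

namespace IsCentral

variable {τ : QN →ₗ[ℂ] ℂ} (h : IsCentral τ)

include h

/-- The gauge automorphisms fix u and e_n, so the composite is again central and uniqueness applies.
-/
theorem apply_gauge (t : Torus) (x : QN) : τ (gauge t x) = τ x := by
  have : IsCentral (τ ∘ₗ (gauge t : QN →⋆ₐ[ℂ] QN).toAlgHom.toLinearMap) := by
    refine ⟨⟨?_, fun x => ?_⟩, fun x => ?_, fun n x => ?_⟩
    · exact (congrArg τ (map_one (gauge t))).trans h.state.1
    · obtain ⟨r, hr, hx⟩ := h.state.2 (gauge t x)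
      refine ⟨r, hr, ?_⟩
      rw [← hx, ← map_star, ← map_mul]
      rfl
    · change τ (gauge t (u * x)) = τ (gauge t (x * u))
      rw [map_mul (gauge t), map_mul (gauge t), gauge_u, h.u_mul]
    · change τ (gauge t (e n * x)) = τ (gauge t (x * e n))
      rw [map_mul (gauge t), map_mul (gauge t), gauge_e, h.e_mul]
  exact LinearMap.congr_fun (this.eq h) x

theorem apply_expectation (x : QN) : τ (expectation x) = τ x := by
  let τ' : QN →L[ℂ] ℂ := ⟨τ, h.state.continuous⟩
  have := τ'.integral_comp_comm (integrable_gauge x)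
  change ∫ t, τ (gauge t x) ∂torusHaar = τ (expectation x) at this
  rw [← this]
  simp [h.apply_gauge]

/-- The centralizer of a state is a closed ⋆-subalgebra, and this one contains the generators of F.
-/
theorem mul_comm_of_mem_F {y : QN} (hy : y ∈ F) (x : QN) : τ (y * x) = τ (x * y) := by
  let S : StarSubalgebra ℂ QN :=
    { carrier := {y | ∀ x, τ (y * x) = τ (x * y)}
      mul_mem' := fun {a b} ha hb x => by rw [mul_assoc, ha, mul_assoc, hb, mul_assoc]
      one_mem' := fun x => by rw [one_mul, mul_one]
      add_mem' := fun {a b} ha hb x => by rw [add_mul, mul_add, map_add, map_add, ha, hb]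
      zero_mem' := fun x => by rw [zero_mul, mul_zero]
      algebraMap_mem' := fun r x => by rw [Algebra.commutes]
      star_mem' := fun {a} ha x => by
        have := congrArg star (ha (star x))
        rw [← h.state.map_star, ← h.state.map_star, star_mul, star_mul, star_star] at this
        exact this.symm }
  have hcl : IsClosed (S : Set QN) := by
    have : (S : Set QN) = ⋂ x, {y | τ (y * x) = τ (x * y)} := by
      ext y
      simp only [Set.mem_iInter]
      rfl
    rw [this]
    have hc := h.state.continuous
    exact isClosed_iInter fun x => isClosed_eq (by fun_prop) (by fun_prop)
  exact F_le hcl h.u_mul h.e_mul hy x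

/-- The restriction of a central state to `F` is the unique tracial state. -/
theorem isTracialState_restrict : IsTracialState (τ ∘ₗ F.subtype.toAlgHom.toLinearMap) :=
  ⟨⟨h.state.1, fun x => h.state.2 x⟩, fun x y => h.mul_comm_of_mem_F x.2 y⟩

/-- σ ∘ E is central, hence equal to τ, and E is the identity on F. -/
theorem eq_restrict {σ : F →ₗ[ℂ] ℂ} (hσ : IsTracialState σ) :
    σ = τ ∘ₗ F.subtype.toAlgHom.toLinearMap := by
  refine LinearMap.ext fun x => ?_
  rw [← (isCentral_extend hσ).eq h]
  change σ x = σ ⟨expectation x, _⟩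
  congr 1
  exact Subtype.ext (expectation_of_mem_F x.2).symm

end IsCentral

end CuntzQN

end

noncomputable section

namespace CuntzQN

/-! ### The representation on `ℓ²(ℤ)` and the existence of a central state -/

open Filter Topology

section Representation

/-- The Hilbert space `ℓ²(ℤ)`. -/
abbrev HilbertZ : Type := lp (fun _ : ℤ => ℂ) 2

/-- The standard basis of `ℓ²(ℤ)`. -/
def basisZ : HilbertBasis ℤ ℂ HilbertZ := ⟨LinearIsometryEquiv.refl ℂ _⟩

theorem ext_basisZ {S T : HilbertZ →L[ℂ] HilbertZ} (h : ∀ k, S (basisZ k) = T (basisZ k)) :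
    S = T := by
  refine ContinuousLinearMap.ext_on
    (Submodule.dense_iff_topologicalClosure_eq_top.2 basisZ.dense_span) ?_
  rintro _ ⟨k, rfl⟩
  exact h k

/-- The isometry of `ℓ²(ℤ)` induced by an injective map. -/
def shiftOp (f : ℤ → ℤ) (hf : Function.Injective f) : HilbertZ →L[ℂ] HilbertZ :=
  (basisZ.orthonormal.comp f hf).orthogonalFamily.linearIsometry.toContinuousLinearMap

theorem shiftOp_apply {f : ℤ → ℤ} (hf : Function.Injective f) (k : ℤ) :
    shiftOp f hf (basisZ k) = basisZ (f k) := by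
  have h1 : basisZ k = (lp.single 2 k (1 : ℂ) : HilbertZ) := by
    rw [← basisZ.repr_symm_single]
    rfl
  rw [h1]
  change (basisZ.orthonormal.comp f hf).orthogonalFamily.linearIsometry (lp.single 2 k (1 : ℂ)) = _
  rw [OrthogonalFamily.linearIsometry_apply_single]
  simp

theorem star_shiftOp_mul_shiftOp {f : ℤ → ℤ} (hf : Function.Injective f) :
    star (shiftOp f hf) * shiftOp f hf = 1 :=
  (ContinuousLinearMap.norm_map_iff_adjoint_comp_self _).1 fun x =>
    LinearIsometry.norm_map _ x

theorem star_shiftOp_apply {f : ℤ → ℤ} (hf : Function.Injective f) (k : ℤ) :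
    star (shiftOp f hf) (basisZ (f k)) = basisZ k := by
  rw [← shiftOp_apply hf]
  exact congrArg (fun T : HilbertZ →L[ℂ] HilbertZ => T (basisZ k)) (star_shiftOp_mul_shiftOp hf)

theorem star_shiftOp_apply_of_notMem {f : ℤ → ℤ} (hf : Function.Injective f) {m : ℤ}
    (hm : m ∉ Set.range f) : star (shiftOp f hf) (basisZ m) = 0 := by
  have hd : Dense (Submodule.span ℂ (Set.range basisZ) : Set HilbertZ) :=
    Submodule.dense_iff_topologicalClosure_eq_top.2 basisZ.dense_span
  refine hd.eq_zero_of_inner_left (𝕜 := ℂ) fun v hv => ?_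
  induction hv using Submodule.span_induction with
  | mem x hx =>
    obtain ⟨k, rfl⟩ := hx
    rw [ContinuousLinearMap.star_eq_adjoint, ContinuousLinearMap.adjoint_inner_left,
      shiftOp_apply]
    exact basisZ.orthonormal.2 fun h => hm ⟨k, h.symm⟩
  | zero => simp
  | add x y _ _ hx hy => rw [inner_add_right, hx, hy, add_zero]
  | smul c x _ hx => rw [inner_smul_right, hx, mul_zero]

/-- The bilateral shift. -/
def opU : HilbertZ →L[ℂ] HilbertZ := shiftOp (fun k => k + 1) (add_left_injective 1)

/-- The isometry given by multiplication of the index by `n`. -/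
def opS (n : ℕ+) : HilbertZ →L[ℂ] HilbertZ :=
  shiftOp (fun k => n * k) (mul_right_injective₀ (by simp))

theorem opU_apply (k : ℤ) : opU (basisZ k) = basisZ (k + 1) := shiftOp_apply _ k

theorem opS_apply (n : ℕ+) (k : ℤ) : opS n (basisZ k) = basisZ (n * k) := shiftOp_apply _ k

theorem star_opU_apply (k : ℤ) : star opU (basisZ k) = basisZ (k - 1) := by
  have := star_shiftOp_apply (add_left_injective (1 : ℤ)) (k - 1)
  rwa [sub_add_cancel] at this

theorem star_opS_apply (n : ℕ+) (k : ℤ) :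
    star (opS n) (basisZ k) = if (n : ℤ) ∣ k then basisZ (k / n) else 0 := by
  split_ifs with h
  · obtain ⟨l, rfl⟩ := h
    rw [Int.mul_ediv_cancel_left _ (by simp)]
    exact star_shiftOp_apply _ l
  · refine star_shiftOp_apply_of_notMem _ ?_
    rintro ⟨l, rfl⟩
    exact h (dvd_mul_right _ _)

theorem opS_star_opS_apply (n : ℕ+) (k : ℤ) :
    (opS n * star (opS n)) (basisZ k) = if (n : ℤ) ∣ k then basisZ k else 0 := by
  rw [mul_apply_eq_comp, star_opS_apply]
  split_ifs with h
  · rw [opS_apply, Int.mul_ediv_cancel' h]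
  · rw [map_zero]

theorem opU_pow_apply (j : ℕ) (k : ℤ) : (opU ^ j) (basisZ k) = basisZ (k + j) := by
  induction j generalizing k with
  | zero => simp
  | succ j ih =>
    rw [pow_succ, mul_apply_eq_comp, opU_apply, ih]
    congr 1
    push_cast
    ring

theorem star_opU_pow_apply (j : ℕ) (k : ℤ) : star (opU ^ j) (basisZ k) = basisZ (k - j) := by
  rw [star_pow]
  induction j generalizing k with
  | zero => simp
  | succ j ih =>
    rw [pow_succ, mul_apply_eq_comp, star_opU_apply, ih]
    congr 1
    push_cast
    ring

theorem relations_op : Relations opS opU where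
  isometry n := star_shiftOp_mul_shiftOp _
  unitary := by
    refine Unitary.mem_iff.2 ⟨star_shiftOp_mul_shiftOp _, ext_basisZ fun k => ?_⟩
    rw [mul_apply_eq_comp, star_opU_apply, opU_apply, sub_add_cancel]
    rfl
  mul n m := ext_basisZ fun k => by
    rw [mul_apply_eq_comp, opS_apply, opS_apply, opS_apply]
    congr 1
    push_cast
    ring
  semiconj n := ext_basisZ fun k => by
    rw [mul_apply_eq_comp, mul_apply_eq_comp, opS_apply, opU_apply,
      opS_apply, opU_pow_apply]
    congr 1
    ring
  sum_eq_one n := ext_basisZ fun m => by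
    have hterm : ∀ j : ℕ, (opU ^ j * (opS n * star (opS n)) * star (opU ^ j)) (basisZ m) =
        if (n : ℤ) ∣ m - j then basisZ m else 0 := by
      intro j
      rw [mul_apply_eq_comp, star_opU_pow_apply, mul_apply_eq_comp,
        opS_star_opS_apply]
      split_ifs
      · rw [opU_pow_apply, sub_add_cancel]
      · rw [map_zero]
    rw [sum_apply]
    simp only [hterm]
    have hn : (0 : ℤ) < n := by exact_mod_cast n.pos
    obtain ⟨r, hr⟩ := Int.eq_ofNat_of_zero_le (Int.emod_nonneg m hn.ne')
    have hrn := Int.emod_lt_of_pos m hn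
    -- The ranges of the n projections are spanned by the residue classes mod n; only the class r of
    -- m contributes.
    rw [Finset.sum_eq_single r]
    · rw [if_pos, one_apply_eq_self]
      rw [← hr]
      exact Int.dvd_self_sub_emod
    · intro j hj hjr
      rw [if_neg]
      intro hd
      apply hjr
      have hj' : (j : ℤ) < n := by exact_mod_cast Finset.mem_range.1 hj
      have h1 := Int.emod_emod_of_dvd m (dvd_refl (n : ℤ))
      have h2 := (Int.emod_eq_emod_iff_emod_sub_eq_zero).2 (Int.emod_eq_zero_of_dvd hd)
      rw [Int.emod_eq_of_lt (by positivity) hj'] at h2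
      omega
    · intro hnot
      exfalso
      apply hnot
      rw [Finset.mem_range]
      omega

end Representation

section CesaroMeans

variable (φ : QN →⋆ₐ[ℂ] (HilbertZ →L[ℂ] HilbertZ))

/-- The Cesàro means of the diagonal matrix coefficients of a representation on `ℓ²(ℤ)`. -/
def cesaro (N : ℕ) (x : QN) : ℂ :=
  (N : ℂ)⁻¹ * ∑ k ∈ Finset.range N, inner ℂ (basisZ k) (φ x (basisZ k))

theorem norm_inner_apply_le (x : QN) (k l : ℤ) :
    ‖inner ℂ (basisZ k) (φ x (basisZ l))‖ ≤ ‖x‖ := by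
  refine (norm_inner_le_norm _ _).trans ?_
  rw [basisZ.orthonormal.1, one_mul]
  refine ((φ x).le_opNorm _).trans ?_
  rw [basisZ.orthonormal.1, mul_one]
  exact norm_hom_apply_le φ x

theorem norm_cesaro_le (N : ℕ) (x : QN) : ‖cesaro φ N x‖ ≤ ‖x‖ := by
  rcases Nat.eq_zero_or_pos N with rfl | hN
  · simp [cesaro]
  · have hN' : (0 : ℝ) < N := by exact_mod_cast hN
    rw [cesaro, norm_mul, norm_inv, Complex.norm_natCast, inv_mul_le_iff₀ hN']
    refine (norm_sum_le_of_le _ fun (k : ℕ) _ => norm_inner_apply_le φ x k k).trans ?_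
    simp

theorem exists_tendsto_cesaro (x : QN) :
    ∃ L, Tendsto (fun N => cesaro φ N x) (hyperfilter ℕ : Filter ℕ) (𝓝 L) := by
  have hc := isCompact_closedBall (0 : ℂ) ‖x‖
  obtain ⟨L, -, hL⟩ := hc.ultrafilter_le_nhds ((hyperfilter ℕ).map fun N => cesaro φ N x) (by
    rw [le_principal_iff]
    exact Filter.mem_map.2 (Eventually.of_forall fun N => by
      simpa using norm_cesaro_le φ N x))
  exact ⟨L, hL⟩

/-- A limit of the Cesàro means along a free ultrafilter. -/
def cesaroLimit : QN →ₗ[ℂ] ℂ where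
  toFun x := (exists_tendsto_cesaro φ x).choose
  map_add' x y := by
    refine tendsto_nhds_unique (exists_tendsto_cesaro φ (x + y)).choose_spec ?_
    refine ((exists_tendsto_cesaro φ x).choose_spec.add
      (exists_tendsto_cesaro φ y).choose_spec).congr fun N => ?_
    simp only [cesaro, map_add, add_apply, inner_add_right,
      Finset.sum_add_distrib, mul_add]
  map_smul' c x := by
    refine tendsto_nhds_unique (exists_tendsto_cesaro φ (c • x)).choose_spec ?_
    refine ((exists_tendsto_cesaro φ x).choose_spec.const_mul c).congr fun N => ?_
    simp only [cesaro, map_smul, smul_apply, inner_smul_right,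
      ← Finset.mul_sum]
    ring

theorem tendsto_cesaroLimit (x : QN) :
    Tendsto (fun N => cesaro φ N x) (hyperfilter ℕ : Filter ℕ) (𝓝 (cesaroLimit φ x)) :=
  (exists_tendsto_cesaro φ x).choose_spec

theorem hyperfilter_le_atTop : (hyperfilter ℕ : Filter ℕ) ≤ atTop :=
  Nat.hyperfilter_le_atTop

theorem isState_cesaroLimit : IsState (cesaroLimit φ) := by
  constructor
  · refine tendsto_nhds_unique (tendsto_cesaroLimit φ 1) (tendsto_const_nhds.congr' ?_)
    -- The mean for N = 0 is 0 by convention; the free ultrafilter ignores it.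
    filter_upwards [hyperfilter_le_atTop (eventually_gt_atTop 0)] with N hN
    have : (N : ℂ) ≠ 0 := by exact_mod_cast hN.ne'
    simp [cesaro, inner_self_eq_norm_sq_to_K, basisZ.orthonormal.1, this]
  · intro x
    have hcl : IsClosed {z : ℂ | ∃ r : ℝ, 0 ≤ r ∧ z = r} := by
      have : {z : ℂ | ∃ r : ℝ, 0 ≤ r ∧ z = r} = {z | 0 ≤ z.re} ∩ {z | z.im = 0} := by
        ext z
        constructor
        · rintro ⟨r, hr, rfl⟩
          simpa using hr
        · rintro ⟨h1, h2⟩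
          exact ⟨z.re, h1, Complex.ext rfl h2⟩
      rw [this]
      exact (isClosed_le continuous_const Complex.continuous_re).inter
        (isClosed_eq Complex.continuous_im continuous_const)
    refine hcl.mem_of_tendsto (tendsto_cesaroLimit φ (star x * x)) (Eventually.of_forall fun N => ?_)
    refine ⟨(N : ℝ)⁻¹ * ∑ k ∈ Finset.range N, ‖φ x (basisZ k)‖ ^ 2, by positivity, ?_⟩
    have : ∀ k : ℤ, inner ℂ (basisZ k) (φ (star x * x) (basisZ k)) =
        ((‖φ x (basisZ k)‖ ^ 2 : ℝ) : ℂ) := by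
      intro k
      rw [map_mul, map_star, mul_apply_eq_comp, ContinuousLinearMap.star_eq_adjoint,
        ContinuousLinearMap.adjoint_inner_right, inner_self_eq_norm_sq_to_K]
      simp
    simp only [cesaro, this]
    push_cast
    rfl

/-- Interchanging u and x shifts the averaging window by one place, so the means differ by at most
2‖x‖/N. The projections e_n are diagonal in the standard basis, so for them the means agree for
every N. -/
theorem isCentral_cesaroLimit (hu : φ u = opU) (hs : ∀ n, φ (s n) = opS n) :
    IsCentral (cesaroLimit φ) where
  state := isState_cesaroLimit φ
  u_mul x := by
    refine sub_eq_zero.1 ?_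
    refine tendsto_nhds_unique ((tendsto_cesaroLimit φ (u * x)).sub
      (tendsto_cesaroLimit φ (x * u))) ?_
    let c : ℤ → ℂ := fun k => inner ℂ (basisZ (k - 1)) (φ x (basisZ k))
    have h1 : ∀ k : ℤ, inner ℂ (basisZ k) (φ (u * x) (basisZ k)) = c k := by
      intro k
      rw [map_mul, mul_apply_eq_comp, hu, ← ContinuousLinearMap.adjoint_inner_left,
        ← ContinuousLinearMap.star_eq_adjoint, star_opU_apply]
    have h2 : ∀ k : ℤ, inner ℂ (basisZ k) (φ (x * u) (basisZ k)) = c (k + 1) := by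
      intro k
      rw [map_mul, mul_apply_eq_comp, hu, opU_apply]
      simp only [c, add_sub_cancel_right]
    have h3 : ∀ N : ℕ, cesaro φ N (u * x) - cesaro φ N (x * u) = (N : ℂ)⁻¹ * (c 0 - c N) := by
      intro N
      simp only [cesaro, h1, h2]
      rw [← mul_sub, ← Finset.sum_sub_distrib]
      congr 1
      exact_mod_cast Finset.sum_range_sub' (fun k : ℕ => c k) N
    simp only [h3]
    have hinv : Tendsto (fun N : ℕ => (N : ℝ)⁻¹ * (2 * ‖x‖)) (hyperfilter ℕ : Filter ℕ) (𝓝 0) := by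
      have := (tendsto_inv_atTop_nhds_zero_nat (𝕜 := ℝ)).mul_const (2 * ‖x‖)
      rw [zero_mul] at this
      exact this.mono_left hyperfilter_le_atTop
    refine squeeze_zero_norm (fun N => ?_) hinv
    rw [norm_mul, norm_inv, Complex.norm_natCast, two_mul]
    gcongr
    exact (norm_sub_le _ _).trans
      (add_le_add (norm_inner_apply_le φ x _ _) (norm_inner_apply_le φ x _ _))
  e_mul n x := by
    refine tendsto_nhds_unique (tendsto_cesaroLimit φ (e n * x))
      ((tendsto_cesaroLimit φ (x * e n)).congr fun N => Eq.symm ?_)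
    simp only [cesaro]
    congr 1
    refine Finset.sum_congr rfl fun k _ => ?_
    have he : φ (e n) = opS n * star (opS n) := by rw [e, map_mul, map_star, hs]
    have hsa : star (opS n * star (opS n)) = opS n * star (opS n) := by
      rw [star_mul, star_star]
    rw [map_mul, map_mul, mul_apply_eq_comp, mul_apply_eq_comp, he,
      ← ContinuousLinearMap.adjoint_inner_left, ← ContinuousLinearMap.star_eq_adjoint, hsa,
      opS_star_opS_apply]
    split_ifs <;> simp

end CesaroMeans

theorem exists_isCentral : ∃ τ : QN →ₗ[ℂ] ℂ, IsCentral τ := by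
  obtain ⟨φ, hs, hu⟩ := exists_lift relations_op
  exact ⟨cesaroLimit φ, isCentral_cesaroLimit φ hu hs⟩

end CuntzQN

end

noncomputable section

namespace CuntzQN

/-! ### Scaling relations for central states -/

namespace IsCentral

variable {τ : QN →ₗ[ℂ] ℂ} (h : IsCentral τ)

include h

theorem apply_e (n : ℕ+) : τ (e n) = (n : ℂ)⁻¹ := by
  rw [← monomial_eq_e, h.apply_monomial]
  simp

/-- n τ(s_n · s_n^*) is again central: it is normalised because τ(e_n) = 1/n, and s_n u = u^n s_n
and s_n e_m = e_{nm} s_n carry centrality over. Uniqueness identifies it with τ. -/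
theorem apply_conj (n : ℕ+) (x : QN) : τ (s n * x * star (s n)) = (n : ℂ)⁻¹ * τ x := by
  have hn : (n : ℂ) ≠ 0 := by exact_mod_cast n.ne_zero
  have key : IsCentral ((n : ℂ) • τ ∘ₗ (LinearMap.mulLeft ℂ (s n)) ∘ₗ
      (LinearMap.mulRight ℂ (star (s n)))) := by
    have happ : ∀ x, ((n : ℂ) • τ ∘ₗ (LinearMap.mulLeft ℂ (s n)) ∘ₗ
      (LinearMap.mulRight ℂ (star (s n)))) x = n * τ (s n * (x * star (s n))) := fun x => rfl
    refine ⟨⟨?_, fun x => ?_⟩, fun x => ?_, fun m x => ?_⟩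
    · have := h.apply_e n
      rw [happ, one_mul]
      rw [e] at this
      rw [this, mul_inv_cancel₀ hn]
    · obtain ⟨r, hr, hx⟩ := h.state.2 (x * star (s n))
      refine ⟨n * r, by positivity, ?_⟩
      rw [star_mul, star_star] at hx
      rw [happ, mul_assoc (star x), ← mul_assoc, hx]
      push_cast
      rfl
    · rw [happ, happ]
      congr 1
      have h1 : s n * (u * x * star (s n)) = U n * (s n * (x * star (s n))) := by
        rw [← U_one, ← mul_assoc, ← mul_assoc, s_mul_U, mul_one]
        simp only [mul_assoc]
      have h2 : s n * (x * u * star (s n)) = s n * (x * star (s n)) * U n := by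
        rw [← U_one, mul_assoc x, U_mul_star_s, mul_one]
        simp only [mul_assoc]
      rw [h1, h2, h.U_mul]
    · rw [happ, happ]
      congr 1
      have h1 : s n * (e m * x * star (s n)) = e (n * m) * (s n * (x * star (s n))) := by
        rw [e, e, ← s_mul_s, star_mul]
        have : ∀ y, star (s n) * (s n * y) = y := fun y => by
          rw [← mul_assoc, star_s_mul_s, one_mul]
        simp only [mul_assoc, this]
      have h2 : s n * (x * e m * star (s n)) = s n * (x * star (s n)) * e (n * m) := by
        rw [e, e, ← s_mul_s, star_mul]
        have : ∀ y, star (s n) * (s n * y) = y := fun y => by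
          rw [← mul_assoc, star_s_mul_s, one_mul]
        simp only [mul_assoc, this]
      rw [h1, h2, h.e_mul]
  have := LinearMap.congr_fun (key.eq h) x
  change (n : ℂ) * τ (s n * (x * star (s n))) = τ x at this
  rw [← this, mul_assoc, inv_mul_cancel_left₀ hn]

/-- Since s_n = e_n s_n and e_n is in the centralizer, τ(s_n x) = τ(s_n (x s_n) s_n^*). -/
theorem s_mul (n : ℕ+) (x : QN) : τ (s n * x) = (n : ℂ)⁻¹ * τ (x * s n) := by
  have h1 : s n * x = e n * (s n * x) := by
    rw [e, mul_assoc, ← mul_assoc (star (s n)), star_s_mul_s, one_mul]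
  rw [h1, h.e_mul, ← h.apply_conj, e]
  simp only [mul_assoc]

theorem star_s_mul (n : ℕ+) (x : QN) : τ (star (s n) * x) = n * τ (x * star (s n)) := by
  have hn : (n : ℂ) ≠ 0 := by exact_mod_cast n.ne_zero
  have h1 := congrArg star (h.s_mul n (star x))
  rw [star_mul', ← h.state.map_star, ← h.state.map_star, star_mul, star_mul, star_star,
    star_inv₀, star_natCast] at h1
  rw [h1, mul_inv_cancel_left₀ hn]

/-- The algebraic form of the KMS condition: b/a is the factor by which the flow, continued to time
i, multiplies the monomial. -/
theorem monomial_mul (i : ℤ) (a b : ℕ+) (j : ℤ) (x : QN) :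
    τ (monomial i a b j * x) = (b / a : ℂ) * τ (x * monomial i a b j) := by
  simp only [monomial, mul_assoc]
  rw [h.U_mul]
  simp only [mul_assoc]
  rw [h.s_mul]
  simp only [mul_assoc]
  rw [h.star_s_mul]
  simp only [mul_assoc]
  rw [h.U_mul]
  simp only [mul_assoc]
  ring

end IsCentral

end CuntzQN

end

noncomputable section

namespace CuntzQN

/-! ### The standard flow -/

/-- The point `(p ^ (i t))_p` of the torus. -/
def primePowers (t : ℝ) : Torus := fun p => Circle.exp (t * Real.log p)

theorem weight_primePowers (t : ℝ) (n : ℕ+) :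
    weight (primePowers t) n = Circle.exp (t * Real.log n) := by
  suffices h : ∀ (m : ℕ) (k : ℕ+), (k : ℕ) = m →
      weight (primePowers t) k = Circle.exp (t * Real.log m) from h n n rfl
  intro m
  induction m using induction_on_primes with
  | zero => intro k hk; exact absurd hk k.ne_zero
  | one =>
    intro k hk
    simp [weight, hk]
  | prime_mul p m hp ih =>
    intro k hk
    have hm : 0 < m := Nat.pos_of_mul_pos_left (hk ▸ k.pos)
    let p' : ℕ+ := ⟨p, hp.pos⟩
    let m' : ℕ+ := ⟨m, hm⟩
    have hw : weight (primePowers t) p' = Circle.exp (t * Real.log p) := by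
      let q : Nat.Primes := ⟨p, hp⟩
      rw [weight, finprod_eq_single _ q]
      · change primePowers t q ^ p.factorization p = _
        rw [hp.factorization_self, pow_one]
        rfl
      · intro r hr
        have : p.factorization r = 0 := by
          rw [hp.factorization, Finsupp.single_eq_of_ne]
          intro h
          exact hr (Subtype.ext h)
        change primePowers t r ^ p.factorization r = _
        rw [this, pow_zero]
    have hmul : k = p' * m' := PNat.eq hk
    have hp0 : (p : ℝ) ≠ 0 := by exact_mod_cast hp.ne_zero
    have hm0 : (m : ℝ) ≠ 0 := by exact_mod_cast hm.ne'
    rw [hmul, weight_mul, hw, ih m' rfl, ← Circle.exp_add, Nat.cast_mul, Real.log_mul hp0 hm0,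
      mul_add]

theorem primePowers_zero : primePowers 0 = 1 := by
  funext p
  simp [primePowers]

theorem primePowers_add (t t' : ℝ) : primePowers (t + t') = primePowers t * primePowers t' := by
  funext p
  simp [primePowers, add_mul, Circle.exp_add]

theorem continuous_primePowers : Continuous primePowers := by
  unfold primePowers
  fun_prop

theorem gauge_one : gauge 1 = StarAlgHom.id ℂ QN :=
  hom_ext (fun n => by simp [weight]) rfl

theorem gauge_mul (t t' : Torus) : gauge (t * t') = (gauge t).comp (gauge t') :=
  hom_ext (fun n => by
    rw [StarAlgHom.comp_apply, gauge_s, gauge_s, map_smul, gauge_s, smul_smul, weight_mul_left,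
      Circle.coe_mul, mul_comm]) (by rw [StarAlgHom.comp_apply, gauge_u, gauge_u, gauge_u])

/-- The one-parameter group determined by `s n ↦ n ^ (i t) • s n` and `u ↦ u`. -/
def standardFlow : OneParameterGroup QN where
  toFun t := StarAlgEquiv.ofStarAlgHom (gauge (primePowers t)) (gauge (primePowers (-t)))
    (by rw [← gauge_mul, ← primePowers_add, neg_add_cancel, primePowers_zero, gauge_one])
    (by rw [← gauge_mul, ← primePowers_add, add_neg_cancel, primePowers_zero, gauge_one])
  map_zero x := by
    change gauge (primePowers 0) x = x
    rw [primePowers_zero, gauge_one]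
    rfl
  map_add t t' x := by
    change gauge (primePowers (t + t')) x = gauge (primePowers t) (gauge (primePowers t') x)
    rw [primePowers_add, gauge_mul]
    rfl
  continuous x := (continuous_gauge x).comp continuous_primePowers

theorem standardFlow_apply (t : ℝ) (x : QN) : standardFlow t x = gauge (primePowers t) x := rfl

theorem standardFlow_u (t : ℝ) : standardFlow t u = u := gauge_u _

theorem standardFlow_e (t : ℝ) (n : ℕ+) : standardFlow t (e n) = e n := gauge_e _ n

theorem standardFlow_s (t : ℝ) (n : ℕ+) :
    standardFlow t (s n) = ((n : ℂ) ^ (t * Complex.I)) • s n := by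
  have hn : (n : ℂ) ≠ 0 := by exact_mod_cast n.ne_zero
  rw [standardFlow_apply, gauge_s, weight_primePowers, Circle.coe_exp, Complex.cpow_def_of_ne_zero hn,
    ← Complex.natCast_log]
  congr 2
  push_cast
  ring

theorem standardFlow_monomial (t : ℝ) (i : ℤ) (a b : ℕ+) (j : ℤ) :
    standardFlow t (monomial i a b j) =
      Complex.exp (Complex.I * (Real.log a - Real.log b : ℝ) * t) • monomial i a b j := by
  rw [standardFlow_apply, gauge_monomial, weight_primePowers, weight_primePowers]
  congr 1
  rw [Complex.star_def, ← Circle.coe_inv_eq_conj, ← Circle.exp_neg, Circle.coe_exp, Circle.coe_exp,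
    ← Complex.exp_add]
  congr 1
  push_cast
  ring

/-! ### The KMS condition -/

open Complex Set Filter Topology

/-- `f` witnesses the 1-KMS condition for the pair `x, y`. -/
structure IsKMSFunction {A : Type*} [CStarAlgebra A] (lam : OneParameterGroup A) (τ : A →ₗ[ℂ] ℂ)
    (x y : A) (f : ℂ → ℂ) : Prop where
  continuousOn : ContinuousOn f {z | 0 ≤ z.im ∧ z.im ≤ 1}
  differentiableOn : DifferentiableOn ℂ f {z | 0 < z.im ∧ z.im < 1}
  real : ∀ t : ℝ, f t = τ (x * lam t y)
  add_I : ∀ t : ℝ, f (t + I) = τ (lam t y * x)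

theorem isKMS_one_iff {A : Type*} [CStarAlgebra A] {lam : OneParameterGroup A} {τ : A →ₗ[ℂ] ℂ} :
    IsKMS 1 lam τ ↔ ∀ x y, ∃ f, IsKMSFunction lam τ x y f := by
  refine forall_congr' fun x => forall_congr' fun y => exists_congr fun f => ?_
  constructor
  · rintro ⟨h1, h2, h3, h4⟩
    exact ⟨h1, h2, h3, by simpa using h4⟩
  · rintro ⟨h1, h2, h3, h4⟩
    exact ⟨h1, h2, h3, by simpa using h4⟩

/-- The three lines theorem for bounded functions. -/
theorem norm_le_of_strip {f : ℂ → ℂ} {B C : ℝ}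
    (hc : ContinuousOn f {z | 0 ≤ z.im ∧ z.im ≤ 1})
    (hd : DifferentiableOn ℂ f {z | 0 < z.im ∧ z.im < 1})
    (hB : ∀ z : ℂ, 0 ≤ z.im → z.im ≤ 1 → ‖f z‖ ≤ B)
    (h0 : ∀ t : ℝ, ‖f t‖ ≤ C) (h1 : ∀ t : ℝ, ‖f (t + I)‖ ≤ C)
    {z : ℂ} (hz0 : 0 ≤ z.im) (hz1 : z.im ≤ 1) : ‖f z‖ ≤ C := by
  refine PhragmenLindelof.horizontal_strip (a := 0) (b := 1) (f := f) ⟨hd, ?_⟩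
    ⟨0, by positivity, 0, ?_⟩ ?_ ?_ hz0 hz1
  · rw [closure_preimage_im, closure_Ioo zero_ne_one]
    exact hc
  · simp only [zero_mul, Real.exp_zero]
    refine Asymptotics.IsBigO.of_bound B ?_
    refine eventually_inf_principal.2 (Eventually.of_forall fun w hw => ?_)
    simpa using hB w hw.1.le hw.2.le
  · intro w hw
    have : w = (w.re : ℂ) := by apply Complex.ext <;> simp [hw]
    rw [this]
    exact h0 _
  · intro w hw
    have : w = (w.re : ℂ) + I := by apply Complex.ext <;> simp [hw]
    rw [this]
    exact h1 _

section

variable {A : Type*} [CStarAlgebra A] {lam : OneParameterGroup A} {τ : A →ₗ[ℂ] ℂ}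

namespace IsKMSFunction

theorem add {x y y' : A} {f g : ℂ → ℂ} (hf : IsKMSFunction lam τ x y f)
    (hg : IsKMSFunction lam τ x y' g) : IsKMSFunction lam τ x (y + y') fun z => f z + g z where
  continuousOn := hf.continuousOn.add hg.continuousOn
  differentiableOn := hf.differentiableOn.add hg.differentiableOn
  real t := by rw [hf.real, hg.real, map_add, mul_add, map_add]
  add_I t := by rw [hf.add_I, hg.add_I, map_add, add_mul, map_add]

theorem const_smul {x y : A} {f : ℂ → ℂ} (hf : IsKMSFunction lam τ x y f) (c : ℂ) :
    IsKMSFunction lam τ x (c • y) fun z => c * f z where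
  continuousOn := hf.continuousOn.const_mul c
  differentiableOn := hf.differentiableOn.const_mul c
  real t := by rw [hf.real, map_smul, mul_smul_comm, map_smul, smul_eq_mul]
  add_I t := by rw [hf.add_I, map_smul, smul_mul_assoc, map_smul, smul_eq_mul]

theorem sub {x y y' : A} {f g : ℂ → ℂ} (hf : IsKMSFunction lam τ x y f)
    (hg : IsKMSFunction lam τ x y' g) : IsKMSFunction lam τ x (y - y') fun z => f z - g z := by
  have := hf.add (hg.const_smul (-1))
  simpa [sub_eq_add_neg] using this

theorem eq {x y : A} {f g : ℂ → ℂ} (hf : IsKMSFunction lam τ x y f)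
    (hg : IsKMSFunction lam τ x y g) {z : ℂ} (hz0 : 0 ≤ z.im) (hz1 : z.im ≤ 1) : f z = g z := by
  have := eq_zero_of_real_eq_zero (f := fun z => f z - g z)
    (hf.continuousOn.sub hg.continuousOn) (hf.differentiableOn.sub hg.differentiableOn)
    (fun t => by rw [hf.real, hg.real, sub_self]) ⟨hz0, hz1⟩
  exact sub_eq_zero.1 this

theorem translate {x y : A} {f : ℂ → ℂ} (hf : IsKMSFunction lam τ x y f) (t : ℝ) :
    IsKMSFunction lam τ x (lam t y) fun z => f (z + t) where
  continuousOn := hf.continuousOn.comp (by fun_prop) fun z hz => by simpa using hz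
  differentiableOn := hf.differentiableOn.comp (by fun_prop) fun z hz => by simpa using hz
  real t' := by rw [← ofReal_add, hf.real, lam.map_add]
  add_I t' := by rw [add_right_comm, ← ofReal_add, hf.add_I, lam.map_add]

end IsKMSFunction

/-- A bound for the functionals `y ↦ τ (x * y)` and `y ↦ τ (y * x)`. -/
theorem IsState.exists_bound_mul (hτ : IsState τ) (x : A) :
    ∃ C, 0 < C ∧ (∀ y, ‖τ (x * y)‖ ≤ C * ‖y‖) ∧ ∀ y, ‖τ (y * x)‖ ≤ C * ‖y‖ := by
  obtain ⟨C, hC, h⟩ := hτ.exists_bound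
  refine ⟨C * (‖x‖ + 1), by positivity, fun y => (h _).trans ?_, fun y => (h _).trans ?_⟩
  · rw [mul_assoc]
    gcongr
    exact (norm_mul_le _ _).trans (by gcongr; linarith)
  · rw [mul_assoc, mul_comm _ ‖y‖]
    gcongr
    exact (norm_mul_le _ _).trans (by gcongr; linarith)

theorem norm_flow (t : ℝ) (y : A) : ‖lam t y‖ = ‖y‖ := StarAlgEquiv.norm_map (lam t) y

/-- The elements with bounded KMS functions form a closed set. -/
theorem isClosed_bounded_isKMSFunction (hτ : IsState τ) (x : A) :
    IsClosed {y | ∃ f C, IsKMSFunction lam τ x y f ∧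
      ∀ z : ℂ, 0 ≤ z.im → z.im ≤ 1 → ‖f z‖ ≤ C} := by
  obtain ⟨K, hK, hK1, hK2⟩ := hτ.exists_bound_mul x
  -- The three lines theorem replaces an arbitrary bound `C` by one linear in ‖y‖, so KMS functions
  -- of a convergent sequence converge uniformly on the strip. This is why boundedness is part of
  -- the set.
  have hbd : ∀ y f C, IsKMSFunction lam τ x y f → (∀ z : ℂ, 0 ≤ z.im → z.im ≤ 1 → ‖f z‖ ≤ C) →
      ∀ z : ℂ, 0 ≤ z.im → z.im ≤ 1 → ‖f z‖ ≤ K * ‖y‖ := by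
    intro y f C hf hC z hz0 hz1
    refine norm_le_of_strip hf.continuousOn hf.differentiableOn hC (fun t => ?_) (fun t => ?_) hz0 hz1
    · rw [hf.real, ← norm_flow (lam := lam) t y]
      exact hK1 _
    · rw [hf.add_I, ← norm_flow (lam := lam) t y]
      exact hK2 _
  refine isClosed_of_closure_subset fun y hy => ?_
  obtain ⟨ys, hys, hlim⟩ := mem_closure_iff_seq_limit.1 hy
  choose f C hf hC using hys
  let S : Set ℂ := {z | 0 ≤ z.im ∧ z.im ≤ 1}
  have hdist : ∀ m n, ∀ z ∈ S, ‖f m z - f n z‖ ≤ K * ‖ys m - ys n‖ := by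
    intro m n z hz
    refine hbd _ _ (C m + C n) ((hf m).sub (hf n)) (fun w hw0 hw1 => ?_) z hz.1 hz.2
    exact (norm_sub_le _ _).trans (add_le_add (hC m w hw0 hw1) (hC n w hw0 hw1))
  have hcau : UniformCauchySeqOn f atTop S := by
    rw [Metric.uniformCauchySeqOn_iff]
    intro ε hε
    obtain ⟨N, hN⟩ := Metric.cauchySeq_iff.1 hlim.cauchySeq (ε / K) (by positivity)
    refine ⟨N, fun m hm n hn z hz => ?_⟩
    have h1 := hN m hm n hn
    rw [dist_eq_norm, lt_div_iff₀ hK] at h1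
    rw [dist_eq_norm]
    refine (hdist m n z hz).trans_lt ?_
    linarith
  let g : ℂ → ℂ := fun z => limUnder atTop fun n => f n z
  have hg : ∀ z ∈ S, Tendsto (fun n => f n z) atTop (𝓝 (g z)) := fun z hz =>
    (hcau.cauchySeq hz).tendsto_limUnder
  have hunif := hcau.tendstoUniformlyOn_of_tendsto hg
  refine ⟨g, K * ‖y‖, ⟨?_, ?_, fun t => ?_, fun t => ?_⟩, fun z hz0 hz1 => ?_⟩
  · exact hunif.continuousOn (Frequently.of_forall fun n => (hf n).continuousOn)
  · have hsub : {z : ℂ | 0 < z.im ∧ z.im < 1} ⊆ S := fun z hz => ⟨hz.1.le, hz.2.le⟩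
    refine (hunif.mono hsub).tendstoLocallyUniformlyOn.differentiableOn
      (Eventually.of_forall fun n => (hf n).differentiableOn) ?_
    exact (isOpen_lt continuous_const continuous_im).inter
      (isOpen_lt continuous_im continuous_const)
  · have h1 := hg t ⟨by simp, by simp⟩
    simp only [(hf _).real] at h1
    have hc : Continuous fun y => τ (x * lam t y) := by
      have h2 := hτ.continuous
      have h3 : Continuous (lam t) := (StarAlgEquiv.isometry (lam t)).continuous
      fun_prop
    exact tendsto_nhds_unique h1 ((hc.tendsto y).comp hlim)
  · have h1 := hg (t + I) ⟨by simp, by simp⟩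
    simp only [(hf _).add_I] at h1
    have hc : Continuous fun y => τ (lam t y * x) := by
      have h2 := hτ.continuous
      have h3 : Continuous (lam t) := (StarAlgEquiv.isometry (lam t)).continuous
      fun_prop
    exact tendsto_nhds_unique h1 ((hc.tendsto y).comp hlim)
  · exact le_of_tendsto_of_tendsto' (hg z ⟨hz0, hz1⟩).norm (hlim.norm.const_mul K)
      fun n => hbd _ _ _ (hf n) (hC n) z hz0 hz1

/-- Elements fixed by a flow belong to the centralizer of a KMS state. -/
theorem IsKMS.mul_comm_of_fixed (hτ : IsKMS 1 lam τ) {y : A} (hy : ∀ t, lam t y = y) (x : A) :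
    τ (x * y) = τ (y * x) := by
  obtain ⟨f, hf⟩ := isKMS_one_iff.1 hτ x y
  -- The KMS function is constant on the real line, hence on the strip; its value at i is τ(yx).
  have := eq_zero_of_real_eq_zero (f := fun z => f z - τ (x * y))
    (hf.continuousOn.sub continuousOn_const) (hf.differentiableOn.sub_const _)
    (fun t => by rw [hf.real, hy, sub_self]) (z := (0 : ℝ) + I) (by simp)
  rw [hf.add_I, hy, sub_eq_zero] at this
  exact this.symm

end

theorem exp_sub_log (a b : ℕ+) : Complex.exp (Real.log a - Real.log b : ℝ) = (a / b : ℂ) := by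
  have ha : (0 : ℝ) < a := by exact_mod_cast a.pos
  have hb : (0 : ℝ) < b := by exact_mod_cast b.pos
  rw [← Complex.ofReal_exp, Real.exp_sub, Real.exp_log ha, Real.exp_log hb]
  push_cast
  rfl

/-- On a monomial the flow is multiplication by exp(iLt) with L = log a − log b, which is entire in
t and equals b/a at t = i, the scaling factor of τ. Density and closedness of the elements with
bounded KMS functions give the rest. -/
theorem IsCentral.isKMS_standardFlow {τ : QN →ₗ[ℂ] ℂ} (h : IsCentral τ) :
    IsKMS 1 standardFlow τ := by
  rw [isKMS_one_iff]
  intro x y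
  obtain ⟨f, -, hf, -⟩ : ∃ f C, IsKMSFunction standardFlow τ x y f ∧
      ∀ z : ℂ, 0 ≤ z.im → z.im ≤ 1 → ‖f z‖ ≤ C := by
    refine monomial_induction (p := fun y => ∃ f C, IsKMSFunction standardFlow τ x y f ∧
      ∀ z : ℂ, 0 ≤ z.im → z.im ≤ 1 → ‖f z‖ ≤ C) ?_ ?_ ?_
      (isClosed_bounded_isKMSFunction h.state x) y
    · rintro y y' ⟨f, C, hf, hC⟩ ⟨f', C', hf', hC'⟩
      exact ⟨_, C + C', hf.add hf', fun z h0 h1 =>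
        (norm_add_le _ _).trans (add_le_add (hC z h0 h1) (hC' z h0 h1))⟩
    · rintro c y ⟨f, C, hf, hC⟩
      refine ⟨_, ‖c‖ * C, hf.const_smul c, fun z h0 h1 => ?_⟩
      rw [norm_mul]
      exact mul_le_mul_of_nonneg_left (hC z h0 h1) (norm_nonneg c)
    · intro i a b j
      let L : ℝ := Real.log a - Real.log b
      refine ⟨fun z => exp (I * L * z) * τ (x * monomial i a b j),
        Real.exp |L| * ‖τ (x * monomial i a b j)‖, ⟨?_, ?_, fun t => ?_, fun t => ?_⟩,
        fun z h0 h1 => ?_⟩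
      · fun_prop
      · fun_prop
      · rw [standardFlow_monomial, mul_smul_comm, map_smul, smul_eq_mul]
      · have ha : (a : ℂ) ≠ 0 := by exact_mod_cast a.ne_zero
        have hb : (b : ℂ) ≠ 0 := by exact_mod_cast b.ne_zero
        rw [standardFlow_monomial, smul_mul_assoc, map_smul, smul_eq_mul, h.monomial_mul, ← mul_assoc]
        congr 1
        have : I * L * (t + I) = I * L * t + -(L : ℂ) := by
          linear_combination (L : ℂ) * I_mul_I
        rw [this, Complex.exp_add, Complex.exp_neg, exp_sub_log, inv_div]
      · rw [norm_mul]
        gcongr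
        rw [Complex.norm_exp]
        gcongr
        have : (I * L * z).re = - L * z.im := by simp
        rw [this]
        refine (le_abs_self _).trans ?_
        rw [abs_mul, abs_neg, abs_of_nonneg h0]
        exact mul_le_of_le_one_right (abs_nonneg L) h1
  exact ⟨f, hf⟩

theorem IsCanonicalKMSState.isCentral {σ : QN →ₗ[ℂ] ℂ} (h : IsCanonicalKMSState σ) :
    IsCentral σ := by
  obtain ⟨hσ, lam, hfix, hkms⟩ := h
  exact ⟨hσ, fun x => (hkms.mul_comm_of_fixed (fun t => (hfix t).1) x).symm,
    fun n x => (hkms.mul_comm_of_fixed (fun t => (hfix t).2 n) x).symm⟩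

theorem IsCentral.isCanonicalKMSState {τ : QN →ₗ[ℂ] ℂ} (h : IsCentral τ) :
    IsCanonicalKMSState τ :=
  ⟨h.state, standardFlow, fun t => ⟨standardFlow_u t, standardFlow_e t⟩, h.isKMS_standardFlow⟩

end CuntzQN

end

noncomputable section

namespace CuntzQN

/-! ### Faithfulness of the central state -/

open MeasureTheory Filter Topology

/-- The expectation onto `F` is faithful. -/
theorem eq_zero_of_expectation_eq_zero {a : QN} (ha : 0 ≤ a) (h : expectation a = 0) : a = 0 := by
  have hbound : ∀ ε > 0, ‖a‖ ≤ ε := by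
    intro ε hε
    let V : Set Torus := {t | ‖gauge t a - a‖ < ε}
    have hV : IsOpen V :=
      isOpen_lt ((continuous_gauge a).sub continuous_const).norm continuous_const
    have hV1 : (1 : Torus) ∈ V := by
      change ‖gauge 1 a - a‖ < ε
      rw [show gauge 1 a = a by rw [gauge_one]; rfl, sub_self, norm_zero]
      exact hε
    have hpos : 0 < torusHaar.real V :=
      ENNReal.toReal_pos (hV.measure_pos _ ⟨1, hV1⟩).ne' (measure_ne_top _ _)
    -- Near the identity α_t(a) ≥ a − ε, and elsewhere α_t(a) ≥ 0. Integrating gives |V| (a − ε) ≤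
    -- E(a) = 0, where |V| > 0.
    have hle : (V.indicator fun _ => a - algebraMap ℝ QN ε) ≤ fun t => gauge t a := by
      intro t
      by_cases ht : t ∈ V
      · rw [Set.indicator_of_mem ht]
        have hsa : IsSelfAdjoint (a - gauge t a) :=
          (IsSelfAdjoint.of_nonneg ha).sub (IsSelfAdjoint.of_nonneg (map_nonneg (gauge t) ha))
        have h1 : a - gauge t a ≤ algebraMap ℝ QN ‖a - gauge t a‖ := hsa.le_algebraMap_norm_self
        have h2 : algebraMap ℝ QN ‖a - gauge t a‖ ≤ algebraMap ℝ QN ε := by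
          refine algebraMap_mono QN ?_
          rw [norm_sub_rev]
          exact le_of_lt ht
        have h3 := h1.trans h2
        rw [sub_le_iff_le_add] at h3 ⊢
        rwa [add_comm]
      · rw [Set.indicator_of_notMem ht]
        exact map_nonneg (gauge t) ha
    have hint := integral_mono ((integrable_const _).indicator hV.measurableSet)
      (integrable_gauge a) hle
    rw [integral_indicator_const _ hV.measurableSet] at hint
    change _ ≤ expectation a at hint
    rw [h, smul_nonpos_iff_nonpos_of_pos_left hpos, sub_nonpos] at hint
    rwa [CStarAlgebra.norm_le_iff_le_algebraMap a hε.le ha]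
  exact norm_le_zero_iff.1 (le_of_forall_pos_le_add fun ε hε => by simpa using hbound ε hε)

theorem U_mem_elemental (k : ℤ) : U k ∈ StarAlgebra.elemental ℂ u := by
  have hn : ∀ k : ℕ, U k ∈ StarAlgebra.elemental ℂ u := fun k => by
    rw [U_natCast]
    exact pow_mem (StarAlgebra.elemental.self_mem ℂ u) k
  obtain ⟨k, rfl | rfl⟩ := k.eq_nat_or_neg
  · exact hn k
  · rw [← star_U]
    exact star_mem (hn k)

theorem star_s_mul_U_mul_s_mem_elemental (n : ℕ+) (k : ℤ) :
    star (s n) * U k * s n ∈ StarAlgebra.elemental ℂ u := by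
  rw [star_s_mul_U_mul_s]
  split_ifs
  · exact U_mem_elemental _
  · exact zero_mem _

/-- The elements all of whose entries with respect to the matrix units of level `n` belong to the
`C⋆`-algebra generated by `u`. -/
def levelAlgebra (n : ℕ+) : StarSubalgebra ℂ QN where
  -- Letting i and j range over all integers, not only 0, …, n−1, makes closure under products and
  -- adjoints a matter of changing signs.
  carrier := {x | ∀ i j, star (s n) * U i * x * U j * s n ∈ StarAlgebra.elemental ℂ u}
  mul_mem' := by
    intro x y hx hy i j
    have : star (s n) * U i * (x * y) * U j * s n = ∑ k ∈ Finset.range (n : ℕ),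
        (star (s n) * U i * x * U k * s n) * (star (s n) * U (-k) * y * U j * s n) := by
      have h : x * y = x * (∑ k ∈ Finset.range (n : ℕ), U k * s n * (star (s n) * U (-k))) * y := by
        rw [sum_U_e, mul_one]
      rw [h, Finset.mul_sum, Finset.sum_mul, Finset.mul_sum, Finset.sum_mul, Finset.sum_mul]
      refine Finset.sum_congr rfl fun k _ => ?_
      simp only [mul_assoc]
    rw [this]
    exact sum_mem fun k _ => mul_mem (hx i k) (hy (-k) j)
  one_mem' := by
    intro i j
    rw [mul_one, mul_assoc (star (s n)), ← U_add]
    exact star_s_mul_U_mul_s_mem_elemental n _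
  add_mem' := by
    intro x y hx hy i j
    rw [mul_add, add_mul, add_mul]
    exact add_mem (hx i j) (hy i j)
  zero_mem' := by
    intro i j
    simp
  algebraMap_mem' := by
    intro r i j
    rw [Algebra.algebraMap_eq_smul_one, mul_smul_comm, smul_mul_assoc, smul_mul_assoc, mul_one,
      mul_assoc (star (s n)), ← U_add]
    exact SMulMemClass.smul_mem r (star_s_mul_U_mul_s_mem_elemental n _)
  star_mem' := by
    intro x hx i j
    have := star_mem (hx (-j) (-i))
    simpa only [star_mul, star_star, star_U, neg_neg, mul_assoc] using this

theorem isClosed_levelAlgebra (n : ℕ+) : IsClosed (levelAlgebra n : Set QN) := by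
  have : (levelAlgebra n : Set QN) = ⋂ i, ⋂ j,
      {x | star (s n) * U i * x * U j * s n ∈ StarAlgebra.elemental ℂ u} := by
    ext x
    simp only [Set.mem_iInter]
    rfl
  rw [this]
  refine isClosed_iInter fun i => isClosed_iInter fun j => ?_
  exact (StarAlgebra.elemental.isClosed ℂ u).preimage (by fun_prop)

theorem monomial_mem_levelAlgebra (i : ℤ) (a m : ℕ+) (j : ℤ) :
    monomial i a a j ∈ levelAlgebra (a * m) := by
  intro k l
  have : star (s (a * m)) * U k * monomial i a a j * U l * s (a * m) =
      star (s m) * (star (s a) * U (k + i) * s a) * (star (s a) * U (j + l) * s a) * s m := by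
    rw [← s_mul_s, star_mul, monomial, U_add, U_add]
    simp only [mul_assoc]
  rw [this, star_s_mul_U_mul_s, star_s_mul_U_mul_s]
  split_ifs
  · rw [mul_assoc (star (s m)), ← U_add]
    exact star_s_mul_U_mul_s_mem_elemental m _
  all_goals simp

theorem exists_expectation_mem_levelAlgebra {x : QN} (hx : x ∈ monomialSpan) :
    ∃ n : ℕ+, expectation x ∈ levelAlgebra n := by
  -- Membership at all multiples of n is what survives addition, by passing to a common multiple of
  -- the levels.
  suffices h : ∃ n : ℕ+, ∀ m, expectationL x ∈ levelAlgebra (n * m) from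
    ⟨_, h.choose_spec 1⟩
  refine monomialSpan_induction (p := fun x => ∃ n : ℕ+, ∀ m, expectationL x ∈ levelAlgebra (n * m))
    ?_ ?_ ?_ ?_ hx
  · exact ⟨1, fun m => by rw [map_zero]; exact zero_mem _⟩
  · rintro x y ⟨n, hn⟩ ⟨n', hn'⟩
    refine ⟨n * n', fun m => ?_⟩
    rw [map_add]
    refine add_mem ?_ ?_
    · rw [mul_assoc]
      exact hn _
    · rw [mul_comm n, mul_assoc]
      exact hn' _
  · rintro c x ⟨n, hn⟩
    refine ⟨n, fun m => ?_⟩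
    rw [map_smul]
    exact SMulMemClass.smul_mem c (hn m)
  · intro i a b j
    refine ⟨a, fun m => ?_⟩
    rw [expectationL_apply, expectation_monomial]
    split_ifs with hab
    · subst hab
      exact monomial_mem_levelAlgebra i a m j
    · exact zero_mem _

section

variable {B : Type*} [CStarAlgebra B] (φ : QN →⋆ₐ[ℂ] B)

/-- A representation is faithful on the `C⋆`-algebra generated by `u` if the image of `u` has full
spectrum. -/
theorem eq_zero_of_mem_elemental (hφ : Metric.sphere (0 : ℂ) 1 ⊆ spectrum ℂ (φ u)) {x : QN}
    (hx : x ∈ StarAlgebra.elemental ℂ u) (h : φ x = 0) : x = 0 := by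
  have hu : IsStarNormal u := ⟨by
    have := Unitary.mem_iff.1 relations.unitary
    rw [commute_iff_eq, this.1, this.2]⟩
  have hφu : IsStarNormal (φ u) := hu.map φ
  have hx' : x ∈ (StarAlgebra.elemental ℂ u : Set QN) := hx
  rw [← range_cfc ℂ hu] at hx'
  obtain ⟨f, rfl⟩ := hx'
  simp only at h ⊢
  by_cases hf : ContinuousOn f (spectrum ℂ u)
  · have hsub : spectrum ℂ (φ u) ⊆ spectrum ℂ u := AlgHom.spectrum_apply_subset φ u
    rw [StarAlgHomClass.map_cfc φ f u hf (map_continuous φ)] at h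
    rw [← cfc_zero ℂ u]
    refine cfc_congr fun z hz => ?_
    have hz' := hφ (Unitary.spectrum_subset_circle unitaryU hz)
    have := norm_apply_le_norm_cfc f (φ u) hz' (hf.mono hsub)
    rw [h, norm_zero] at this
    simpa using norm_le_zero_iff.1 this
  -- For discontinuous `f` the functional calculus has the default value 0.
  · exact cfc_apply_of_not_continuousOn u hf

theorem eq_zero_of_mem_levelAlgebra (hφ : Metric.sphere (0 : ℂ) 1 ⊆ spectrum ℂ (φ u)) {n : ℕ+}
    {x : QN} (hx : x ∈ levelAlgebra n) (h : φ x = 0) : x = 0 := by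
  have hent : ∀ i j, star (s n) * U i * x * U j * s n = 0 := fun i j =>
    eq_zero_of_mem_elemental φ hφ (hx i j) (by simp only [map_mul, h, mul_zero, zero_mul])
  have : x = (∑ k ∈ Finset.range (n : ℕ), U k * s n * (star (s n) * U (-k))) * x *
      ∑ l ∈ Finset.range (n : ℕ), U l * s n * (star (s n) * U (-l)) := by
    rw [sum_U_e, one_mul, mul_one]
  rw [this, Finset.sum_mul, Finset.sum_mul_sum]
  refine Finset.sum_eq_zero fun k _ => Finset.sum_eq_zero fun l _ => ?_
  have h1 : U k * s n * (star (s n) * U (-k)) * x * (U l * s n * (star (s n) * U (-l))) =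
      U k * s n * (star (s n) * U (-k) * x * U l * s n) * (star (s n) * U (-l)) := by
    simp only [mul_assoc]
  rw [h1, hent, mul_zero, zero_mul]

/-- An injective ⋆-homomorphism of C⋆-algebras is isometric. Unlike injectivity, the norm identity
passes to limits of elements of varying level. -/
theorem norm_map_of_mem_levelAlgebra (hφ : Metric.sphere (0 : ℂ) 1 ⊆ spectrum ℂ (φ u)) {n : ℕ+}
    {x : QN} (hx : x ∈ levelAlgebra n) : ‖φ x‖ = ‖x‖ := by
  have := isClosed_levelAlgebra n
  let _ : CStarAlgebra (levelAlgebra n) := StarSubalgebra.cstarAlgebra (levelAlgebra n)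
  let ψ : levelAlgebra n →⋆ₐ[ℂ] B := φ.comp (levelAlgebra n).subtype
  have hinj : Function.Injective ψ := by
    rw [injective_iff_map_eq_zero]
    intro y hy
    exact Subtype.ext (eq_zero_of_mem_levelAlgebra φ hφ y.2 hy)
  exact (AddMonoidHomClass.isometry_iff_norm ψ).1 (NonUnitalStarAlgHom.isometry ψ hinj) ⟨x, hx⟩

/-- A representation is faithful on `F` if the image of `u` has full spectrum. -/
theorem eq_zero_of_mem_F (hφ : Metric.sphere (0 : ℂ) 1 ⊆ spectrum ℂ (φ u)) {x : QN}
    (hx : x ∈ F) (h : φ x = 0) : x = 0 := by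
  obtain ⟨y, hy, hlim⟩ := mem_closure_iff_seq_limit.1 (dense_monomialSpan x)
  -- Applying E to monomial approximants of x ∈ F keeps the limit and puts each approximant into
  -- some level algebra.
  have h1 : Tendsto (fun k => expectationL (y k)) atTop (𝓝 x) := by
    have := (expectationL.continuous.tendsto x).comp hlim
    rwa [expectationL_apply, expectation_of_mem_F hx] at this
  have h2 := (((map_continuous φ).tendsto x).comp h1).norm
  rw [h, norm_zero] at h2
  have h3 : ∀ k, ‖φ (expectationL (y k))‖ = ‖expectationL (y k)‖ := fun k => by
    obtain ⟨n, hn⟩ := exists_expectation_mem_levelAlgebra (hy k)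
    exact norm_map_of_mem_levelAlgebra φ hφ hn
  simp only [Function.comp_def, h3] at h2
  exact norm_eq_zero.1 (tendsto_nhds_unique h1.norm h2)

end

/-! ### The GNS representation of a central state. -/

namespace IsCentral

variable {τ : QN →ₗ[ℂ] ℂ} (h : IsCentral τ)

include h

/-- The left kernel of τ is a two-sided ideal: Cauchy–Schwarz gives τ(wx) = 0 for all w, and the
scaling relation moves a monomial from the right end to the left at the cost of a nonzero factor. -/
theorem mul_mul_eq_zero {x : QN} (hx : τ (star x * x) = 0) (y z : QN) : τ (z * x * y) = 0 := by
  refine monomial_induction (p := fun y => τ (z * x * y) = 0) ?_ ?_ ?_ ?_ y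
  · intro y y' hy hy'
    rw [mul_add, map_add, hy, hy', add_zero]
  · intro c y hy
    rw [mul_smul_comm, map_smul, hy, smul_zero]
  · intro i a b j
    have h1 := h.monomial_mul i a b j (z * x)
    have hab : (b / a : ℂ) ≠ 0 := by
      have ha : (a : ℂ) ≠ 0 := by exact_mod_cast a.ne_zero
      have hb : (b : ℂ) ≠ 0 := by exact_mod_cast b.ne_zero
      exact div_ne_zero hb ha
    rw [← mul_assoc, h.state.apply_mul_eq_zero hx, eq_comm, mul_eq_zero] at h1
    exact h1.resolve_left hab
  · have := h.state.continuous
    exact isClosed_eq (by fun_prop) continuous_const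

/-- The GNS representation of a central state. -/
abbrev gns : QN →⋆ₐ[ℂ] (h.state.toPositiveLinearMap.GNS →L[ℂ] h.state.toPositiveLinearMap.GNS) :=
  h.state.toPositiveLinearMap.gnsStarAlgHom

/-- The vector of the GNS space given by an element of the algebra. -/
abbrev gnsVec (x : QN) : h.state.toPositiveLinearMap.GNS :=
  (h.state.toPositiveLinearMap.toPreGNS x : h.state.toPositiveLinearMap.PreGNS)

theorem gns_apply (x y : QN) : h.gns x (h.gnsVec y) = h.gnsVec (x * y) :=
  PositiveLinearMap.gnsNonUnitalStarAlgHom_apply_coe _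

theorem norm_gnsVec_sq (x : QN) : (‖h.gnsVec x‖ : ℂ) ^ 2 = τ (star x * x) := by
  rw [gnsVec, UniformSpace.Completion.norm_coe]
  exact PositiveLinearMap.preGNS_norm_sq _ _

theorem gns_eq_zero {x : QN} (hx : τ (star x * x) = 0) : h.gns x = 0 := by
  refine ContinuousLinearMap.ext fun v => ?_
  induction v using UniformSpace.Completion.induction_on with
  | hp => exact isClosed_eq (by fun_prop) (by fun_prop)
  | ih y =>
    have h1 := h.norm_gnsVec_sq (x * h.state.toPositiveLinearMap.ofPreGNS y)
    rw [← h.gns_apply, gns_apply, ← mul_assoc, h.mul_mul_eq_zero hx] at h1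
    have h2 := h.gns_apply x (h.state.toPositiveLinearMap.ofPreGNS y)
    have h3 := pow_eq_zero_iff two_ne_zero |>.1 h1
    rw [Complex.ofReal_eq_zero, norm_eq_zero] at h3
    exact h2.trans h3

theorem gnsVec_add (x y : QN) : h.gnsVec (x + y) = h.gnsVec x + h.gnsVec y := by
  rw [gnsVec, map_add, UniformSpace.Completion.coe_add]

theorem gnsVec_smul (c : ℂ) (x : QN) : h.gnsVec (c • x) = c • h.gnsVec x := by
  rw [gnsVec, map_smul, UniformSpace.Completion.coe_smul]

theorem norm_gnsVec_U (k : ℤ) : ‖h.gnsVec (U k)‖ = 1 := by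
  have := h.norm_gnsVec_sq (U k)
  rw [star_U, U_neg_mul_U, h.state.1] at this
  have h1 : ‖h.gnsVec (U k)‖ ^ 2 = 1 := by exact_mod_cast this
  exact (pow_eq_one_iff_of_nonneg (norm_nonneg _) two_ne_zero).1 h1

/-- Approximate eigenvectors: v_R = ∑_{r<R} z^{-r} u^r has norm √R because the powers of u are
orthonormal, whereas (z − u) v_R telescopes to a vector of norm at most 2. Hence z − u has no
bounded left inverse. -/
theorem sphere_subset_spectrum_gns : Metric.sphere (0 : ℂ) 1 ⊆ spectrum ℂ (h.gns u) := by
  intro z hz hunit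
  have hz1 : ‖z‖ = 1 := by simpa using hz
  have hz0 : z ≠ 0 := by
    rintro rfl
    simp at hz1
  obtain ⟨T, hT⟩ := hunit.exists_left_inv
  let v : ℕ → QN := fun R => ∑ r ∈ Finset.range R, z⁻¹ ^ r • U r
  have hv : ∀ R : ℕ, ‖h.gnsVec (v R)‖ ^ 2 = R := by
    intro R
    have h1 := h.norm_gnsVec_sq (v R)
    have h2 : τ (star (v R) * v R) = R := by
      simp only [v]
      rw [star_sum, Finset.sum_mul_sum, map_sum]
      simp only [map_sum, star_smul, star_U, smul_mul_smul_comm, ← U_add, map_smul, h.apply_U,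
        neg_add_eq_zero, Nat.cast_inj, smul_eq_mul, mul_ite, mul_one, mul_zero]
      have h3 : ∀ r ∈ Finset.range R, (∑ r' ∈ Finset.range R,
          if r = r' then star (z⁻¹ ^ r) * z⁻¹ ^ r' else 0) = 1 := by
        intro r hr
        rw [Finset.sum_ite_eq, if_pos hr, Complex.star_def, ← Complex.normSq_eq_conj_mul_self,
          Complex.normSq_eq_norm_sq]
        simp [hz1]
      rw [Finset.sum_congr rfl h3]
      simp
    rw [h2] at h1
    exact_mod_cast h1
  have hb : ∀ R : ℕ, ‖h.gnsVec (v R)‖ ≤ ‖T‖ * 2 := by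
    intro R
    have h1 : (algebraMap ℂ _ z - h.gns u) (h.gnsVec (v R)) =
        h.gnsVec (z • (1 : QN) + (-(z * z⁻¹ ^ R)) • U R) := by
      have h2 : algebraMap ℂ _ z - h.gns u = h.gns (z • 1 - u) := by
        rw [map_sub, map_smul, map_one, Algebra.algebraMap_eq_smul_one]
      rw [h2, h.gns_apply]
      congr 1
      have h3 : ∀ r : ℕ, (z • (1 : QN) - u) * (z⁻¹ ^ r • U r) =
          (z * z⁻¹ ^ r) • U r - (z * z⁻¹ ^ (r + 1)) • U ((r + 1 : ℕ) : ℤ) := by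
        intro r
        rw [sub_mul, smul_mul_smul_comm, one_mul, mul_smul_comm, ← U_one, ← U_add]
        congr 2
        · rw [pow_succ']
          field_simp
        · push_cast
          ring_nf
      simp only [v]
      rw [Finset.mul_sum, Finset.sum_congr rfl fun r _ => h3 r,
        Finset.sum_range_sub' (fun r : ℕ => (z * z⁻¹ ^ r) • U (r : ℤ))]
      simp [U_zero, sub_eq_add_neg]
    have h4 : T ((algebraMap ℂ _ z - h.gns u) (h.gnsVec (v R))) = h.gnsVec (v R) :=
      congrArg (fun S : h.state.toPositiveLinearMap.GNS →L[ℂ] h.state.toPositiveLinearMap.GNS =>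
        S (h.gnsVec (v R))) hT
    rw [← h4]
    refine (T.le_opNorm _).trans ?_
    gcongr
    rw [h1, h.gnsVec_add, h.gnsVec_smul, h.gnsVec_smul]
    refine (norm_add_le _ _).trans ?_
    rw [norm_smul, norm_smul, ← U_zero, h.norm_gnsVec_U, h.norm_gnsVec_U]
    simp [hz1]
    norm_num
  obtain ⟨R, hR⟩ := exists_nat_gt ((‖T‖ * 2) ^ 2)
  have := pow_le_pow_left₀ (norm_nonneg _) (hb R) 2
  rw [hv] at this
  linarith

/-- A central state is faithful. -/
theorem eq_zero_of_apply_star_mul_self {x : QN} (hx : τ (star x * x) = 0) : x = 0 := by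
  have ha : 0 ≤ star x * x := star_mul_self_nonneg x
  obtain ⟨b, hb, hbx⟩ := exists_star_mul_self_of_mem_F (expectation_nonneg ha) (expectation_mem_F _)
  have h1 : τ (star b * b) = 0 := by rw [hbx, h.apply_expectation, hx]
  have h2 := eq_zero_of_mem_F h.gns h.sphere_subset_spectrum_gns hb (h.gns_eq_zero h1)
  rw [h2, mul_zero] at hbx
  exact CStarRing.star_mul_self_eq_zero_iff _ |>.1 (eq_zero_of_expectation_eq_zero ha hbx.symm)

end IsCentral

end CuntzQN

end

noncomputable section

namespace CuntzQN

/-! ### Uniqueness of the flow -/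

open Complex Set Filter Topology

section

variable {A : Type*} [CStarAlgebra A] {lam : OneParameterGroup A} {τ : A →ₗ[ℂ] ℂ}

/-- The functions which witness the KMS condition are automatically bounded. -/
theorem IsKMSFunction.exists_bound (hτ : IsState τ) (hkms : IsKMS 1 lam τ) {x y : A} {f : ℂ → ℂ}
    (hf : IsKMSFunction lam τ x y f) :
    ∃ C, ∀ z : ℂ, 0 ≤ z.im → z.im ≤ 1 → ‖f z‖ ≤ C := by
  choose k hk using isKMS_one_iff.1 hkms x
  let K : Set ℂ := Icc (-1) 1 ×ℂ Icc 0 1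
  have hK : IsCompact K := isCompact_Icc.reProdIm isCompact_Icc
  have hKcs : CompactSpace K := isCompact_iff_compactSpace.1 hK
  have hkc : ∀ y, ContinuousOn (k y) K := fun y =>
    (hk y).continuousOn.mono fun z hz => hz.2
  -- Restriction to the rectangle is linear in `y` because a KMS function is determined by its real
  -- values.
  let T : A →ₗ[ℂ] C(K, ℂ) :=
    { toFun := fun y => ⟨K.domRestrict (k y), (hkc y).domRestrict⟩
      map_add' := fun y y' => ContinuousMap.ext fun z =>
        (hk (y + y')).eq ((hk y).add (hk y')) z.2.2.1 z.2.2.2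
      map_smul' := fun c y => ContinuousMap.ext fun z =>
        (hk (c • y)).eq ((hk y).const_smul c) z.2.2.1 z.2.2.2 }
  have hT : Continuous T := by
    -- Closed graph theorem: a uniform limit of KMS functions is holomorphic inside and has the
    -- right values on the bottom edge, so it is the KMS function of the limit.
    refine LinearMap.continuous_of_seq_closed_graph T fun ys y g hys hg => ?_
    have hpt : ∀ z : K, Tendsto (fun n => k (ys n) z) atTop (𝓝 (g z)) := fun z =>
      ((continuous_eval_const z).tendsto g).comp hg
    let g' : ℂ → ℂ := Function.extend Subtype.val g 0
    have hg' : ∀ z : K, g' z = g z := fun z => Subtype.val_injective.extend_apply g 0 z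
    have hunif : TendstoUniformlyOn (fun n => k (ys n)) g' atTop K := by
      rw [tendstoUniformlyOn_iff_tendstoUniformly_comp_coe]
      have h1 := ContinuousMap.tendsto_iff_tendstoUniformly.1 hg
      have h2 : g' ∘ (Subtype.val : K → ℂ) = g := funext hg'
      rw [h2]
      exact h1
    have hgc : ContinuousOn g' K := hunif.continuousOn (Frequently.of_forall fun n => hkc _)
    have hsub : Ioo (-1 : ℝ) 1 ×ℂ Ioo (0 : ℝ) 1 ⊆ K :=
      reProdIm_subset_iff.2 (prod_mono Ioo_subset_Icc_self Ioo_subset_Icc_self)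
    have hgd : DifferentiableOn ℂ g' (Ioo (-1) 1 ×ℂ Ioo 0 1) :=
      (hunif.mono hsub).tendstoLocallyUniformlyOn.differentiableOn
        (Eventually.of_forall fun n => (hk _).differentiableOn.mono fun z hz => hz.2)
        (isOpen_Ioo.reProdIm isOpen_Ioo)
    refine ContinuousMap.ext fun z => ?_
    have h0 := eq_zero_of_bottom_eq_zero (f := fun z => g' z - k y z) one_pos
      (hgc.sub (hkc y)) (hgd.sub ((hk y).differentiableOn.mono fun z hz => hz.2))
      (fun t ht => ?_) z.2
    · rw [← hg']
      exact sub_eq_zero.1 h0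
    · have htK : (t : ℂ) ∈ K := ⟨by simpa using ht, by simp⟩
      have h1 := hpt ⟨t, htK⟩
      rw [← hg'] at h1
      simp only [(hk _).real] at h1
      have hc : Continuous fun y => τ (x * lam t y) := by
        have h2 := hτ.continuous
        have h3 : Continuous (lam t) := (StarAlgEquiv.isometry (lam t)).continuous
        fun_prop
      rw [(hk y).real, sub_eq_zero]
      exact tendsto_nhds_unique h1 ((hc.tendsto y).comp hys)
  obtain ⟨C, hC, hCT⟩ := (⟨T, hT⟩ : A →L[ℂ] C(K, ℂ)).bound
  refine ⟨C * ‖y‖, fun z hz0 hz1 => ?_⟩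
  have hzK : (z.im : ℂ) * I ∈ K := by
    constructor <;> simp [hz0, hz1]
  -- Real translation replaces `y` by an element of the same norm, so the estimate on the imaginary
  -- segment covers the whole strip.
  have h1 : f z = k (lam z.re y) (z.im * I) := by
    rw [(hk (lam z.re y)).eq (hf.translate z.re) (by simpa using hz0) (by simpa using hz1)]
    congr 1
    rw [add_comm, re_add_im]
  have h2 : ‖T (lam z.re y) ⟨z.im * I, hzK⟩‖ ≤ C * ‖y‖ := by
    refine (ContinuousMap.norm_coe_le_norm _ _).trans ?_
    rw [← norm_flow (lam := lam) z.re y]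
    exact hCT _
  rw [h1]
  exact h2

end

namespace IsCentral

variable {τ : QN →ₗ[ℂ] ℂ} (h : IsCentral τ)

include h

/-- For a monomial y and a KMS function f of (y, x), passing from t to t + i multiplies f by a/b and
exp(iLz) by b/a. The product is bounded with equal boundary functions, so it is constant on the real
line. -/
theorem apply_flow_mul_flow {μ : OneParameterGroup QN} (hμ : IsKMS 1 μ τ) (t : ℝ) (x y : QN) :
    τ (standardFlow t y * μ t x) = τ (y * x) := by
  refine monomial_induction (p := fun y => τ (standardFlow t y * μ t x) = τ (y * x)) ?_ ?_ ?_ ?_ y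
  · intro y y' hy hy'
    simp only [map_add, add_mul, hy, hy']
  · intro c y hy
    simp only [map_smul, smul_mul_assoc, hy]
  · intro i a b j
    obtain ⟨f, hf⟩ := isKMS_one_iff.1 hμ (monomial i a b j) x
    obtain ⟨C, hC⟩ := hf.exists_bound h.state hμ
    let L : ℝ := Real.log a - Real.log b
    have hconst := eq_of_periodic_of_bounded (f := fun z => exp (I * L * z) * f z)
      (C := Real.exp |L| * C) (ContinuousOn.mul (by fun_prop) hf.continuousOn)
      (DifferentiableOn.mul (by fun_prop) hf.differentiableOn) (fun t => ?_) (fun z hz0 hz1 => ?_) t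
    · have h0 := hf.real 0
      rw [ofReal_zero, μ.map_zero] at h0
      rw [standardFlow_monomial, smul_mul_assoc, map_smul, smul_eq_mul, ← hf.real, ← h0]
      have h1 : exp (I * L * t) * f t = f 0 := by simpa using hconst
      exact h1
    · have ha : (a : ℂ) ≠ 0 := by exact_mod_cast a.ne_zero
      have hb : (b : ℂ) ≠ 0 := by exact_mod_cast b.ne_zero
      have h1 : I * L * (t + I) = I * L * t + -(L : ℂ) := by
        linear_combination (L : ℂ) * I_mul_I
      rw [hf.real, hf.add_I, h.monomial_mul, h1, Complex.exp_add, Complex.exp_neg, exp_sub_log,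
        inv_div, mul_assoc]
    · rw [norm_mul]
      refine mul_le_mul ?_ (hC z hz0 hz1) (norm_nonneg _) (Real.exp_pos _).le
      rw [Complex.norm_exp]
      gcongr
      have : (I * L * z).re = - L * z.im := by simp
      rw [this]
      refine (le_abs_self _).trans ?_
      rw [abs_mul, abs_neg, abs_of_nonneg hz0]
      exact mul_le_of_le_one_right (abs_nonneg L) hz1
  · have h1 := h.state.continuous
    have h2 : Continuous (standardFlow t) := (StarAlgEquiv.isometry (standardFlow t)).continuous
    exact isClosed_eq (by fun_prop) (by fun_prop)

/-- The standard flow is the only flow for which a central state is KMS. -/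
theorem eq_standardFlow {μ : OneParameterGroup QN} (hμ : IsKMS 1 μ τ) : μ = standardFlow := by
  have key : ∀ t x, μ t x = standardFlow t x := by
    intro t x
    rw [← sub_eq_zero]
    refine h.eq_zero_of_apply_star_mul_self ?_
    -- With σ the standard flow, choose y so that σ_t(y) is the adjoint of the difference. Both
    -- τ(σ_t(y) μ_t(x)) and τ(σ_t(y) σ_t(x)) equal τ(yx), and faithfulness of τ finishes.
    obtain ⟨y, hy⟩ := EquivLike.surjective (standardFlow t) (star (μ t x - standardFlow t x))
    rw [← hy, mul_sub, map_sub, h.apply_flow_mul_flow hμ, h.apply_flow_mul_flow h.isKMS_standardFlow,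
      sub_self]
  have h1 : μ.toFun = standardFlow.toFun := funext fun t => StarAlgEquiv.ext fun x => key t x
  cases μ
  cases hs : standardFlow
  rw [hs] at h1
  cases h1
  rfl

end IsCentral

end CuntzQN

end

theorem mainTheorem4 :
    ∃ (τ₀ : CuntzQN.F →ₗ[ℂ] ℂ) (τ : CuntzQN.QN →ₗ[ℂ] ℂ)
      (lam : CuntzQN.OneParameterGroup CuntzQN.QN),
      -- `τ₀` is the unique tracial state on `F`
      (CuntzQN.IsTracialState τ₀ ∧ ∀ σ, CuntzQN.IsTracialState σ → σ = τ₀) ∧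
      -- `τ` is the unique state with the stated property
      (CuntzQN.IsCanonicalKMSState τ ∧ ∀ σ, CuntzQN.IsCanonicalKMSState σ → σ = τ) ∧
      -- `τ = τ₀ ∘ E`
      (∀ x, ∃ h : CuntzQN.expectation x ∈ CuntzQN.F, τ x = τ₀ ⟨CuntzQN.expectation x, h⟩) ∧
      -- `lam` is the unique one-parameter group for which `τ` is 1-KMS
      (CuntzQN.IsKMS 1 lam τ ∧ ∀ μ, CuntzQN.IsKMS 1 μ τ → μ = lam) ∧
      -- and it is the standard one
      ∀ t : ℝ, (∀ n : ℕ+, lam t (CuntzQN.s n) = ((n : ℂ) ^ (t * Complex.I)) • CuntzQN.s n) ∧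
        lam t CuntzQN.u = CuntzQN.u := by
  obtain ⟨τ, hτ⟩ := CuntzQN.exists_isCentral
  exact ⟨_, τ, CuntzQN.standardFlow, ⟨hτ.isTracialState_restrict, fun σ hσ => hτ.eq_restrict hσ⟩,
    ⟨hτ.isCanonicalKMSState, fun σ hσ => hσ.isCentral.eq hτ⟩,
    fun x => ⟨CuntzQN.expectation_mem_F x, (hτ.apply_expectation x).symm⟩,
    ⟨hτ.isKMS_standardFlow, fun μ hμ => hτ.eq_standardFlow hμ⟩,
    fun t => ⟨CuntzQN.standardFlow_s t, CuntzQN.standardFlow_u t⟩⟩
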